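/- A weighted directed graph $G=(V,m,E,a)$ consists of a node set $V$, masses $m:V\to(0,\infty)$, edges $E\subseteq V\times V$ and weights $a:V\times V\to[0,\infty)$ with $a(x,y)>0$ iff $(x,y)\in E$; the edge $(x,y)$ originates at $y$ and terminates at $x$. Let $V$ be finite. The space $\ell^2(G)$ consists of the functions $V\to\mathbb C$ with inner product $\langle f,g\rangle=\sum_x\overline{f(x)}g(x)m(x)$, and the in-degree Laplacian of $G$ is $$[L^-f](x)=\frac1{m(x)}\Big(d^-(x)f(x)-\sum_{y}a(x,y)f(y)\Big),\qquad d^-(x)=\sum_y a(x,y).$$ Let $\tilde E\subseteq E$ be any set of edges. Write $L^-_{\tilde E}$ and $L^-_{E\setminus\tilde E}$ for the in-degree Laplacians of the graphs obtained from $G$ by keeping only the edges in $\tilde E$, respectively in $E\setminus\tilde E$, and put $L^-_\beta=L^-_{E\setminus\tilde E}+\beta L^-_{\tilde E}$. In $(V,\tilde E)$, a node $i$ sees $j$ if there is a (possibly trivial) directed path from $j$ to $i$. A reach is a maximal set among the sets $\{i: i\text{ sees }j\}$, $j\in V$. The exclusive part $H(R)$ of a reach $R$ is the set of nodes of $R$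 that see no node of any other reach, and its common part is $C(R)=R\setminus H(R)$. For each reach $R$ let: * $\vec\gamma_R:V\to\mathbb R$ be equal to $1$ on $H(R)$, to $0$ outside $R$, and to $-[\chi_{C(R)}L^-_{\tilde E}{\restriction_{C(R)}}]^{-1}[\chi_{C(R)}L^-_{\tilde E}\chi_{H(R)}]$ on $C(R)$; * $\omega_R(i)$ be the sum, over all directed spanning trees of $R$ with edges in $\tilde E$ and root $i\in R$ (edges pointing away from the root), of the product of the weights $a$ of the edges of the tree ($\omega_R(i)=0$ for $i\notin R$), and $\overleftarrow\gamma_R=\omega_R/\sum_i\omega_R(i)m(i)$. Let $P^-=\frac1{2\pi i}\oint_{|z|=\varepsilon}(z-L^-_{\tilde E})^{-1}dz$ (with $\varepsilon>0$ small) be the Riesz projection of $L^-_{\tilde E}$ onto $0$. The reduced graph $\underline G^-$ has the reaches of $(V,\tilde E)$ as its nodes, the masses $\underline m^-(R)=\langle\chi_R,P^-\chi_R\rangle$, the weights $$\underline a^-(R,S)=\underline m^-(R)\sum_{r\in R,\,s\in S}\overleftarrow\gamma_R(r)\,a(r,s)\,\vec\gamma_S(s),$$ and the edges $(R,S)$ with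 $\underline a^-(R,S)>0$. Let $\underline L^-$ be its in-degree Laplacian, and let $$[J^-_\downarrow f](R)=\langle\overleftarrow\gamma_R,f\rangle_{\ell^2(G)},\qquad J^-_\uparrow g=\sum_R g(R)\,\vec\gamma_R .$$ **Theorem.** $\underline G^-$ is a weighted directed graph in the above sense (in particular $\underline m^->0$ and $\underline a^-\ge0$), and for every $t>0$, in the operator norm on $\ell^2(G)$, $$\big\|e^{-tL^-_\beta}-J^-_\uparrow e^{-t\underline L^-}J^-_\downarrow\big\|\longrightarrow 0\qquad\text{as }\beta\to\infty .$$ -/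

import Mathlib

/-- The data of a weighted directed graph `G = (V, m, E, a)`. The pair `(x, y)` stands for the edge
which originates at `y` and terminates at `x`. -/
structure WeightedDigraph (V : Type*) where
  /-- node masses -/
  m : V → ℝ
  /-- edges -/
  E : Set (V × V)
  /-- edge weights -/
  a : V → V → ℝ

namespace WeightedDigraph

/-- The laws of a weighted directed graph: positive masses, non-negative weights, and `E` is exactly
the set on which the weight is positive. -/
structure IsGraph {V : Type*} (G : WeightedDigraph V) : Prop where
  m_pos : ∀ v, 0 < G.m v
  a_nonneg : ∀ x y, 0 ≤ G.a x y
  mem_E : ∀ x y, (x, y) ∈ G.E ↔ 0 < G.a x y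

open Classical in
/-- The graph with the same nodes and masses which keeps only the edges lying in `F`. -/
noncomputable def restrict {V : Type*} (G : WeightedDigraph V) (F : Set (V × V)) :
    WeightedDigraph V where
  m := G.m
  E := G.E ∩ F
  a x y := if (x, y) ∈ F then G.a x y else 0

/-! ### Reaches -/

/-- `i` sees `j`: there is a (possibly trivial) directed path from `j` to `i`. -/
def Sees {V : Type*} (G : WeightedDigraph V) (i j : V) : Prop :=
  Relation.ReflTransGen (fun x y => (x, y) ∈ G.E ∧ G.a x y ≠ 0) i j

/-- All nodes that can be reached from `i` by following directed edges. -/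
def reachableSet {V : Type*} (G : WeightedDigraph V) (i : V) : Set V := {j | G.Sees j i}

/-- A reach is a maximal reachable set. -/
def IsReach {V : Type*} (G : WeightedDigraph V) (R : Set V) : Prop :=
  Maximal (fun S => ∃ i, S = G.reachableSet i) R

/-- The type of all reaches of `G`. -/
def Reach {V : Type*} (G : WeightedDigraph V) : Type _ := {R : Set V // G.IsReach R}

noncomputable instance {V : Type*} [Fintype V] (G : WeightedDigraph V) : Fintype G.Reach :=
  Fintype.ofInjective (fun R : G.Reach => R.1) Subtype.val_injective

/-- The exclusive part of a reach: its nodes which see no node of any other reach. -/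
def exclusivePart {V : Type*} (G : WeightedDigraph V) (R : G.Reach) : Set V :=
  {j | j ∈ R.1 ∧ ∀ S : G.Reach, S ≠ R → ∀ k ∈ S.1, ¬ G.Sees j k}

/-- The common part of a reach: its nodes which also see nodes of some other reach. -/
def commonPart {V : Type*} (G : WeightedDigraph V) (R : G.Reach) : Set V :=
  {j | j ∈ R.1 ∧ ∃ S : G.Reach, S ≠ R ∧ ∃ k ∈ S.1, G.Sees j k}

/-! ### The in-degree Laplacian and the space `ℓ²(G)` -/

/-- The in-degree of a node. -/
noncomputable def inDegree {V : Type*} [Fintype V] (G : WeightedDigraph V) (v : V) : ℝ :=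
  ∑ i, G.a v i

/-- The in-degree Laplacian as a linear map on `𝕜`-valued functions, for `𝕜 = ℝ` or `𝕜 = ℂ`. -/
noncomputable def inLapLin {V : Type*} [Fintype V] (𝕜 : Type*) [RCLike 𝕜]
    (G : WeightedDigraph V) : (V → 𝕜) →ₗ[𝕜] (V → 𝕜) where
  toFun f x := (1 / (G.m x : 𝕜)) * ((G.inDegree x : 𝕜) * f x - ∑ y, (G.a x y : 𝕜) * f y)
  map_add' f g := by
    funext x
    simp only [Pi.add_apply, mul_add, Finset.sum_add_distrib]
    ring
  map_smul' c f := by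
    funext x
    simp only [Pi.smul_apply, smul_eq_mul, RingHom.id_apply, mul_left_comm _ c, ← Finset.mul_sum,
      ← mul_sub]

/-- The in-degree Laplacian as a bounded operator on complex functions. The nodes are finite in
number, so that `ℓ²(G)` is the space of all functions `V → ℂ`. -/
noncomputable def inLap {V : Type*} [Fintype V] (G : WeightedDigraph V) :
    (V → ℂ) →L[ℂ] (V → ℂ) :=
  LinearMap.toContinuousLinearMap (G.inLapLin ℂ)

/-- The inner product of `ℓ²(G)`. -/
noncomputable def ellInner {V : Type*} [Fintype V] (G : WeightedDigraph V) (f g : V → ℂ) : ℂ :=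
  ∑ x, (starRingEnd ℂ) (f x) * g x * (G.m x : ℂ)

/-- The norm of `ℓ²(G)`. -/
noncomputable def ellNorm {V : Type*} [Fintype V] (G : WeightedDigraph V) (f : V → ℂ) : ℝ :=
  Real.sqrt (∑ x, ‖f x‖ ^ 2 * G.m x)

/-- The operator norm of an operator on `ℓ²(G)`. -/
noncomputable def ellOpNorm {V : Type*} [Fintype V] (G : WeightedDigraph V)
    (T : (V → ℂ) →L[ℂ] (V → ℂ)) : ℝ :=
  sInf {C : ℝ | 0 ≤ C ∧ ∀ f, G.ellNorm (T f) ≤ C * G.ellNorm f}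

/-! ### Right and left kernel vectors of the in-degree Laplacian -/

/-- The operator `χ_C · L|_C` on functions on the common part `C` of the reach `R`. -/
noncomputable def commonBlock {V : Type*} [Fintype V] (G : WeightedDigraph V) (R : G.Reach) :
    Module.End ℝ (G.commonPart R → ℝ) :=
  LinearMap.funLeft ℝ ℝ Subtype.val ∘ₗ G.inLapLin ℝ ∘ₗ
    Function.ExtendByZero.linearMap ℝ Subtype.val

open Classical in
/-- The right kernel vector of the reach `R`: equal to `1` on the exclusive part `H`, equal to
`-[χ_C L|_C]⁻¹ [χ_C L χ_H]` on the common part `C`, and `0` outside of `R`. -/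
noncomputable def rightVec {V : Type*} [Fintype V] (G : WeightedDigraph V) (R : G.Reach) (j : V) :
    ℝ :=
  if h : j ∈ G.commonPart R then
    -(Ring.inverse (G.commonBlock R)
      (fun x => G.inLapLin ℝ (Set.indicator (G.exclusivePart R) 1) x.1)) ⟨j, h⟩
  else if j ∈ G.exclusivePart R then 1 else 0

/-- `τ` is (the edge set of) a directed spanning tree of `R` with root `i`: its edges join nodes of
`R`, no edge enters the root, every node has at most one incoming edge, and every node of `R` is
reached from the root along `τ`. -/
structure IsSpanningTree {V : Type*} (G : WeightedDigraph V) (R : Set V) (i : V)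
    (τ : Finset (V × V)) : Prop where
  root_mem : i ∈ R
  edge : ∀ e ∈ τ, e ∈ G.E ∧ e.1 ∈ R ∧ e.2 ∈ R
  root : ∀ e ∈ τ, e.1 ≠ i
  unique_incoming : ∀ e ∈ τ, ∀ e' ∈ τ, e.1 = e'.1 → e = e'
  spanning : ∀ v ∈ R, Relation.ReflTransGen (fun x y => (x, y) ∈ τ) v i

open Classical in
/-- The weight vector of a set of nodes `R` (in use: a reach): the sum over all spanning trees of
`R` rooted at `i` of the products of their edge weights. -/
noncomputable def weightVec {V : Type*} [Fintype V] (G : WeightedDigraph V) (R : Set V) (i : V) :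
    ℝ :=
  ∑ τ : Finset (V × V) with G.IsSpanningTree R i τ, ∏ e ∈ τ, G.a e.1 e.2

/-- The left kernel vector of the reach `R`: the multiple of the weight vector whose inner products
with the functions `e_j` sum up to `1`, that is `∑ j, leftVec j * m j = 1`. -/
noncomputable def leftVec {V : Type*} [Fintype V] (G : WeightedDigraph V) (R : G.Reach) (j : V) :
    ℝ :=
  G.weightVec R.1 j / ∑ i, G.weightVec R.1 i * G.m i

/-! ### The reduced graph -/

/-- The contour integral `(2πi)⁻¹ ∮ (z - B)⁻¹ dz` over the positively oriented circle of radius `ε`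
around `0`. -/
noncomputable def rieszIntegral {V : Type*} [Fintype V] (B : (V → ℂ) →L[ℂ] (V → ℂ)) (ε : ℝ) :
    (V → ℂ) →L[ℂ] (V → ℂ) :=
  (2 * Real.pi * Complex.I : ℂ)⁻¹ • ∮ z in C(0, ε), resolvent B z

/-- The Riesz projection of `B` onto `0`. The contour integral takes one and the same value for all
small `ε > 0` (the circle must not enclose a non-zero point of the spectrum); this is that value. -/
noncomputable def rieszProj {V : Type*} [Fintype V] (B : (V → ℂ) →L[ℂ] (V → ℂ)) :
    (V → ℂ) →L[ℂ] (V → ℂ) :=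
  Filter.limUnder (nhdsWithin (0 : ℝ) (Set.Ioi 0)) (rieszIntegral B)

/-- The reduced graph. Its nodes are the reaches of the graph `(V, F)`. Its masses are
`⟨χ_R, P χ_R⟩` (a real number), with `P` the Riesz projection onto `0` of the in-degree Laplacian
of `F`. -/
noncomputable def reduced {V : Type*} [Fintype V] (G : WeightedDigraph V) (F : Set (V × V)) :
    WeightedDigraph (G.restrict F).Reach :=
  let m' : (G.restrict F).Reach → ℝ := fun R =>
    (G.ellInner (Set.indicator R.1 1)
      (rieszProj (G.restrict F).inLap (Set.indicator R.1 1))).re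
  let a' : (G.restrict F).Reach → (G.restrict F).Reach → ℝ := fun R S =>
    m' R * ∑ r, ∑ s, Set.indicator R.1 1 r * Set.indicator S.1 1 s *
      ((G.restrict F).leftVec R r * G.a r s * (G.restrict F).rightVec S s)
  { m := m'
    a := a'
    E := {e | 0 < a' e.1 e.2} }

/-- The projection `ℓ²(G) → ℓ²` of the reduced graph, `f ↦ (R ↦ ⟨leftVec R, f⟩)`. -/
noncomputable def Jdown {V : Type*} [Fintype V] (G : WeightedDigraph V) (F : Set (V × V)) :
    (V → ℂ) →L[ℂ] ((G.restrict F).Reach → ℂ) :=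
  LinearMap.toContinuousLinearMap
    { toFun := fun f R => G.ellInner (fun v => ((G.restrict F).leftVec R v : ℂ)) f
      map_add' := fun f g => by
        funext R
        simp only [ellInner, Pi.add_apply, mul_add, add_mul, Finset.sum_add_distrib]
      map_smul' := fun c f => by
        funext R
        simp only [ellInner, Pi.smul_apply, smul_eq_mul, RingHom.id_apply, Finset.mul_sum]
        exact Finset.sum_congr rfl fun x _ => by ring }

/-- The interpolation from `ℓ²` of the reduced graph to `ℓ²(G)`, `g ↦ ∑ R, g R • rightVec R`. -/
noncomputable def Jup {V : Type*} [Fintype V] (G : WeightedDigraph V) (F : Set (V × V)) :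
    ((G.restrict F).Reach → ℂ) →L[ℂ] (V → ℂ) :=
  LinearMap.toContinuousLinearMap
    { toFun := fun g v => ∑ R, g R * ((G.restrict F).rightVec R v : ℂ)
      map_add' := fun f g => by
        funext v
        simp only [Pi.add_apply, add_mul, Finset.sum_add_distrib]
      map_smul' := fun c f => by
        funext v
        simp only [Pi.smul_apply, smul_eq_mul, RingHom.id_apply, Finset.mul_sum]
        exact Finset.sum_congr rfl fun x _ => by ring }

/-- The in-degree Laplacian `L_{E ∖ F} + β L_F`, that is, with the weights on `F` scaled by `β`. -/
noncomputable def inLapBeta {V : Type*} [Fintype V] (G : WeightedDigraph V) (F : Set (V × V))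
    (β : ℝ) : (V → ℂ) →L[ℂ] (V → ℂ) :=
  (G.restrict (G.E \ F)).inLap + (β : ℂ) • (G.restrict F).inLap

end WeightedDigraph

/-!
Write `A` and `B` for the in-degree Laplacians of `E ∖ F` and `F`, so that `L_β = A + β B`.

*The kernel of `B`.* By the maximum principle a function in this kernel is determined by its values
at one root of each reach, and the vectors `rightVec` form the basis dual to these evaluations. By
the Markov chain tree theorem the vectors `leftVec`, weighted by the masses, annihilate the range
of `B`. They are supported on the roots of the reaches, hence `J↓ J↑ = 1`, and `P = J↑ J↓` is the
projection onto the kernel of `B` along its range. As `0` is thus a semisimple eigenvalue, `P` is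
the Riesz projection.

*The limit.* A Laplacian `L` with in-degrees at most `c` times the masses satisfies `‖c - L‖ ≤ c` in
the supremum norm. Hence `e^{-tL} = e^{-tc} e^{t(c - L)}` is a contraction, and
`‖e^{-tL} L‖ ≤ √(c / t)`, because the factor `c - n / t` which appears in the expansion of
`e^{t(c - L)} L` in powers of `t (c - L)` has standard deviation `√(c / t)` under the Poisson
distribution of mean `t c`. Applied to `L_β`, where `c` is of order `β`, this gives
`e^{-tL_β} B = O(β^{-1/2})`, and with it the decay of `e^{-tL_β} (1 - P)`, as `1 - P = B S` for some
`S`. On the range of `P`, Duhamel's formula compares `e^{-tL_β}` with `e^{-tAP}`. The defect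
`(1 - P) A P` is removed by the corrector `X = S A P`, up to an error of order `β⁻¹`. Finally
`J↓ A J↑` is the Laplacian of the reduced graph, so `J↓` intertwines it with `A P`.
-/

namespace WeightedDigraph

variable {V : Type*} {G : WeightedDigraph V}

lemma IsGraph.restrict (hG : G.IsGraph) (F : Set (V × V)) : (G.restrict F).IsGraph where
  m_pos := hG.m_pos
  a_nonneg x y := by
    simp only [WeightedDigraph.restrict]
    split_ifs
    exacts [hG.a_nonneg x y, le_rfl]
  mem_E x y := by
    simp only [WeightedDigraph.restrict, Set.mem_inter_iff, hG.mem_E]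
    split_ifs with h <;> simp [h]

lemma IsGraph.a_eq_zero (hG : G.IsGraph) {x y : V} (h : (x, y) ∉ G.E) : G.a x y = 0 :=
  (not_lt.1 fun hpos => h ((hG.mem_E x y).2 hpos)).antisymm (hG.a_nonneg x y)

lemma IsGraph.sees_of_mem (hG : G.IsGraph) {x y : V} (h : (x, y) ∈ G.E) : G.Sees x y :=
  .single ⟨h, ((hG.mem_E x y).1 h).ne'⟩

lemma Sees.refl (x : V) : G.Sees x x := Relation.ReflTransGen.refl

lemma Sees.trans {x y z : V} (hxy : G.Sees x y) (hyz : G.Sees y z) : G.Sees x z :=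
  Relation.ReflTransGen.trans hxy hyz

/-- A root of a reach: a node from which the whole reach can be reached. -/
def IsRoot (R : G.Reach) (r : V) : Prop := R.1 = G.reachableSet r

lemma exists_isRoot (R : G.Reach) : ∃ r, IsRoot R r := R.2.prop

lemma IsRoot.mem {R : G.Reach} {r : V} (hr : IsRoot R r) : r ∈ R.1 := by
  rw [hr]; exact Sees.refl r

lemma IsRoot.sees {R : G.Reach} {r v : V} (hr : IsRoot R r) (hv : v ∈ R.1) : G.Sees v r := by
  rwa [hr] at hv

lemma Reach.mem_of_sees (R : G.Reach) {v w : V} (hw : w ∈ R.1) (h : G.Sees v w) : v ∈ R.1 := by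
  obtain ⟨r, hr⟩ := exists_isRoot R
  have hwr := hr.sees hw
  rw [hr]
  exact h.trans hwr

lemma isRoot_of_forall_sees (R : G.Reach) {r : V} (hr : ∀ v ∈ R.1, G.Sees v r) : IsRoot R r :=
  R.2.eq_of_subset ⟨r, rfl⟩ hr

lemma IsRoot.of_sees {R : G.Reach} {r y : V} (hr : IsRoot R r) (h : G.Sees r y) : IsRoot R y :=
  isRoot_of_forall_sees R fun _ hv => (hr.sees hv).trans h

lemma IsRoot.eq_of_mem {R S : G.Reach} {r : V} (hr : IsRoot R r) (h : r ∈ S.1) : S = R := by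
  obtain ⟨s, hs⟩ := exists_isRoot S
  exact Subtype.ext (hs.trans (hr.of_sees (hs.sees h)).symm)

lemma IsRoot.mem_exclusivePart {R : G.Reach} {r : V} (hr : IsRoot R r) :
    r ∈ G.exclusivePart R :=
  ⟨hr.mem, fun S hS _ hk h => hS (hr.eq_of_mem (S.mem_of_sees hk h))⟩

lemma mem_commonPart_iff {R : G.Reach} {v : V} :
    v ∈ G.commonPart R ↔ v ∈ R.1 ∧ v ∉ G.exclusivePart R := by
  simp only [commonPart, exclusivePart, Set.mem_ofPred_eq]
  push Not
  tauto

lemma exists_reach_mem [Finite V] (v : V) : ∃ R : G.Reach, v ∈ R.1 := by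
  obtain ⟨R, hle, hR⟩ := (Set.toFinite {S : Set V | ∃ i, S = G.reachableSet i}).exists_le_maximal
    ⟨v, rfl⟩
  exact ⟨⟨R, hR⟩, hle (Sees.refl v)⟩

lemma exists_mem_range_sees [Finite V] {ρ : G.Reach → V} (hρ : ∀ R, IsRoot R (ρ R)) (v : V) :
    ∃ r ∈ Set.range ρ, G.Sees v r := by
  obtain ⟨R, hR⟩ := exists_reach_mem (G := G) v
  exact ⟨ρ R, ⟨R, rfl⟩, (hρ R).sees hR⟩

lemma mem_exclusivePart_of_sees [Finite V] {R : G.Reach} {x y : V} (hx : x ∈ G.exclusivePart R)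
    (h : G.Sees x y) : y ∈ G.exclusivePart R := by
  have hy : ∀ S : G.Reach, S ≠ R → ∀ k ∈ S.1, ¬ G.Sees y k :=
    fun S hS k hk hyk => hx.2 S hS k hk (h.trans hyk)
  obtain ⟨T, hT⟩ := exists_reach_mem (G := G) y
  obtain rfl : T = R := by_contra fun hne => hx.2 T hne y hT h
  exact ⟨hT, hy⟩

/-! ### The maximum principle -/

section Laplacian

variable [Fintype V] {𝕜 : Type*} [RCLike 𝕜]

lemma inLapLin_apply (f : V → 𝕜) (x : V) :
    G.inLapLin 𝕜 f x = (1 / (G.m x : 𝕜)) * ∑ y, (G.a x y : 𝕜) * (f x - f y) := by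
  simp only [inLapLin, LinearMap.coe_mk, AddHom.coe_mk, inDegree, mul_sub, Finset.sum_sub_distrib,
    Finset.sum_mul, RCLike.ofReal_sum]

lemma inLapLin_comp {𝕜' : Type*} [RCLike 𝕜'] (φ : 𝕜 →ₗ[ℝ] 𝕜') (f : V → 𝕜) (x : V) :
    G.inLapLin 𝕜' (fun v => φ (f v)) x = φ (G.inLapLin 𝕜 f x) := by
  simp only [inLapLin_apply, ← RCLike.ofReal_one (K := 𝕜), ← RCLike.ofReal_one (K := 𝕜'),
    ← RCLike.ofReal_div, ← RCLike.real_smul_eq_coe_mul, map_smul, map_sum, map_sub]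

lemma inLapLin_eq_zero_of_forall_eq (hG : G.IsGraph) {f : V → 𝕜} {x : V}
    (h : ∀ y, (x, y) ∈ G.E → f y = f x) : G.inLapLin 𝕜 f x = 0 := by
  rw [inLapLin_apply, Finset.sum_eq_zero, mul_zero]
  intro y _
  by_cases hxy : (x, y) ∈ G.E
  · rw [h y hxy, sub_self, mul_zero]
  · rw [hG.a_eq_zero hxy, RCLike.ofReal_zero, zero_mul]

lemma eq_of_inLapLin_nonpos (hG : G.IsGraph) {u : V → ℝ} {x y : V} (hmax : ∀ z, u z ≤ u x)
    (hx : G.inLapLin ℝ u x ≤ 0) (hxy : G.a x y ≠ 0) : u y = u x := by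
  have hterm : ∀ z ∈ Finset.univ, 0 ≤ G.a x z * (u x - u z) := fun z _ =>
    mul_nonneg (hG.a_nonneg x z) (sub_nonneg.2 (hmax z))
  have hsum : ∑ z, G.a x z * (u x - u z) ≤ 0 := by
    rw [inLapLin_apply] at hx
    exact nonpos_of_mul_nonpos_right hx (one_div_pos.2 (hG.m_pos x))
  have hzero := (Finset.sum_eq_zero_iff_of_nonneg hterm).1
    (hsum.antisymm (Finset.sum_nonneg hterm)) y (Finset.mem_univ y)
  linarith [(mul_eq_zero.1 hzero).resolve_left hxy]

theorem nonpos_of_inLapLin_nonpos (hG : G.IsGraph) {u : V → ℝ} {Z : Set V}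
    (hZ : ∀ z ∈ Z, u z ≤ 0) (hu : ∀ x ∉ Z, G.inLapLin ℝ u x ≤ 0)
    (hs : ∀ x, ∃ z ∈ Z, G.Sees x z) (v : V) : u v ≤ 0 := by
  have : Nonempty V := ⟨v⟩
  obtain ⟨x, hx⟩ := Finite.exists_max u
  refine (hx v).trans ?_
  by_contra! hpos
  have hconst : ∀ w, G.Sees x w → u w = u x := by
    intro w hw
    induction hw with
    | refl => rfl
    | @tail b c _ hbc ih =>
      have hb : b ∉ Z := fun h => (hZ b h).not_gt (ih ▸ hpos)
      exact (eq_of_inLapLin_nonpos hG (ih ▸ hx) (hu b hb) hbc.2).trans ih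
  obtain ⟨z, hz, hxz⟩ := hs x
  exact (hZ z hz).not_gt (hconst z hxz ▸ hpos)

theorem eq_zero_of_inLapLin_eq_zero (hG : G.IsGraph) {f : V → 𝕜} {Z : Set V}
    (hZ : ∀ z ∈ Z, f z = 0) (hf : ∀ x ∉ Z, G.inLapLin 𝕜 f x = 0)
    (hs : ∀ x, ∃ z ∈ Z, G.Sees x z) : f = 0 := by
  have hnonpos (φ : 𝕜 →ₗ[ℝ] ℝ) (v : V) : φ (f v) ≤ 0 :=
    nonpos_of_inLapLin_nonpos (u := fun v => φ (f v)) hG (fun z hz => by simp [hZ z hz])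
      (fun x hx => by simp [inLapLin_comp, hf x hx]) hs v
  have hzero (φ : 𝕜 →ₗ[ℝ] ℝ) (v : V) : φ (f v) = 0 :=
    (hnonpos φ v).antisymm (by simpa using hnonpos (-φ) v)
  exact funext fun v => RCLike.ext (by simpa using hzero RCLike.reLm v)
    (by simpa using hzero RCLike.imLm v)

end Laplacian

/-! ### The right kernel vectors -/

section RightVec

variable [Fintype V]

lemma isUnit_commonBlock (hG : G.IsGraph) (R : G.Reach) : IsUnit (G.commonBlock R) := by
  rw [LinearMap.isUnit_iff_ker_eq_bot, LinearMap.ker_eq_bot']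
  intro f hf
  have hext : Function.extend Subtype.val f 0 = 0 := by
    refine eq_zero_of_inLapLin_eq_zero hG (Z := (G.commonPart R)ᶜ)
      (fun z hz => Function.extend_val_apply' hz)
      (fun x hx => congrFun hf ⟨x, not_not.1 hx⟩) fun x => ?_
    by_cases hx : x ∈ G.commonPart R
    · obtain ⟨r, hr⟩ := exists_isRoot R
      exact ⟨r, fun h => (mem_commonPart_iff.1 h).2 hr.mem_exclusivePart, hr.sees hx.1⟩
    · exact ⟨x, hx, Sees.refl x⟩
  funext x
  exact (Function.extend_val_apply x.2).symm.trans (congrFun hext x)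

lemma rightVec_of_mem_exclusivePart {R : G.Reach} {v : V} (h : v ∈ G.exclusivePart R) :
    G.rightVec R v = 1 := by
  simp [rightVec, mem_commonPart_iff, h]

lemma rightVec_of_notMem {R : G.Reach} {v : V} (h : v ∉ R.1) : G.rightVec R v = 0 := by
  have hH : v ∉ G.exclusivePart R := fun hv => h hv.1
  simp [rightVec, mem_commonPart_iff, h, hH]

lemma commonBlock_rightVec (hG : G.IsGraph) (R : G.Reach) (x : G.commonPart R) :
    G.commonBlock R (fun y => G.rightVec R y) x =
      -G.inLapLin ℝ (Set.indicator (G.exclusivePart R) 1) x := by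
  set g : G.commonPart R → ℝ := fun y => G.inLapLin ℝ (Set.indicator (G.exclusivePart R) 1) y
  have hrestrict : (fun y : G.commonPart R => G.rightVec R y) =
      -Ring.inverse (G.commonBlock R) g := by
    funext y
    rw [rightVec, dif_pos y.2, Pi.neg_apply]
  rw [hrestrict, map_neg, ← Module.End.mul_apply,
    Ring.mul_inverse_cancel _ (isUnit_commonBlock hG R), Module.End.one_apply, Pi.neg_apply]

lemma rightVec_eq_indicator_add_extend (R : G.Reach) :
    G.rightVec R = Set.indicator (G.exclusivePart R) 1 +
      Function.extend Subtype.val (fun y : G.commonPart R => G.rightVec R y) 0 := by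
  funext v
  rw [Pi.add_apply]
  by_cases hC : v ∈ G.commonPart R
  · rw [Function.extend_val_apply hC, Set.indicator_of_notMem (mem_commonPart_iff.1 hC).2, zero_add]
  · rw [Function.extend_val_apply' hC, Pi.zero_apply, add_zero]
    by_cases hH : v ∈ G.exclusivePart R
    · rw [rightVec_of_mem_exclusivePart hH, Set.indicator_of_mem hH, Pi.one_apply]
    · rw [Set.indicator_of_notMem hH,
        rightVec_of_notMem fun hv => hC (mem_commonPart_iff.2 ⟨hv, hH⟩)]

lemma inLapLin_rightVec (hG : G.IsGraph) (R : G.Reach) : G.inLapLin ℝ (G.rightVec R) = 0 := by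
  funext x
  rw [Pi.zero_apply]
  by_cases hC : x ∈ G.commonPart R
  · rw [rightVec_eq_indicator_add_extend, map_add, Pi.add_apply]
    exact add_eq_zero_iff_neg_eq.2 (commonBlock_rightVec hG R ⟨x, hC⟩).symm
  refine inLapLin_eq_zero_of_forall_eq hG fun y hxy => ?_
  have hsees := hG.sees_of_mem hxy
  by_cases hx : x ∈ R.1
  · have hH : x ∈ G.exclusivePart R := by_contra fun h => hC (mem_commonPart_iff.2 ⟨hx, h⟩)
    rw [rightVec_of_mem_exclusivePart hH,
      rightVec_of_mem_exclusivePart (mem_exclusivePart_of_sees hH hsees)]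
  · rw [rightVec_of_notMem hx, rightVec_of_notMem fun hy => hx (R.mem_of_sees hy hsees)]

lemma rightVec_of_isRoot [DecidableEq G.Reach] {R S : G.Reach} {r : V} (hr : IsRoot R r) :
    G.rightVec S r = if S = R then 1 else 0 := by
  split_ifs with h
  · exact rightVec_of_mem_exclusivePart (h ▸ hr.mem_exclusivePart)
  · exact rightVec_of_notMem fun hS => h (hr.eq_of_mem hS)

lemma rightVec_nonneg (hG : G.IsGraph) (R : G.Reach) (v : V) : 0 ≤ G.rightVec R v := by
  classical
  choose ρ hρ using exists_isRoot (G := G)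
  refine neg_nonpos.1 (nonpos_of_inLapLin_nonpos (u := -G.rightVec R) hG ?_
    (fun x _ => by simp [inLapLin_rightVec hG R]) (exists_mem_range_sees hρ) v)
  rintro _ ⟨S, rfl⟩
  rw [Pi.neg_apply, rightVec_of_isRoot (hρ S)]
  split_ifs <;> simp

lemma inLapLin_sum_mul_rightVec (hG : G.IsGraph) {𝕜 : Type*} [RCLike 𝕜] (g : G.Reach → 𝕜) :
    G.inLapLin 𝕜 (fun v => ∑ R, g R * (G.rightVec R v : 𝕜)) = 0 := by
  have hR (R : G.Reach) : G.inLapLin 𝕜 (fun v => (G.rightVec R v : 𝕜)) = 0 := funext fun x => by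
    simpa [inLapLin_rightVec hG R] using
      inLapLin_comp (G := G) (RCLike.ofRealAm (K := 𝕜)).toLinearMap (G.rightVec R) x
  have hsum : (fun v => ∑ R, g R * (G.rightVec R v : 𝕜)) =
      ∑ R, g R • fun v => (G.rightVec R v : 𝕜) := by
    funext v
    simp only [Finset.sum_apply, Pi.smul_apply, smul_eq_mul]
  rw [hsum, map_sum]
  exact Finset.sum_eq_zero fun R _ => by rw [map_smul, hR, smul_zero]

theorem eq_sum_rightVec_of_inLapLin_eq_zero (hG : G.IsGraph) {𝕜 : Type*} [RCLike 𝕜]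
    {ρ : G.Reach → V} (hρ : ∀ R, IsRoot R (ρ R)) {f : V → 𝕜} (hf : G.inLapLin 𝕜 f = 0) (v : V) :
    f v = ∑ R, f (ρ R) * (G.rightVec R v : 𝕜) := by
  classical
  suffices h : f - (fun v => ∑ R, f (ρ R) * (G.rightVec R v : 𝕜)) = 0 from
    congrFun (sub_eq_zero.1 h) v
  refine eq_zero_of_inLapLin_eq_zero hG ?_ (fun x _ => ?_) (exists_mem_range_sees hρ)
  · rintro _ ⟨S, rfl⟩
    simp [rightVec_of_isRoot (hρ S), apply_ite (RCLike.ofReal (K := 𝕜))]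
  · rw [map_sub, hf, inLapLin_sum_mul_rightVec hG, sub_zero, Pi.zero_apply]

lemma sum_rightVec (hG : G.IsGraph) (v : V) : ∑ R, G.rightVec R v = 1 := by
  choose ρ hρ using exists_isRoot (G := G)
  have hone : G.inLapLin ℝ (1 : V → ℝ) = 0 := funext fun x =>
    inLapLin_eq_zero_of_forall_eq hG fun _ _ => rfl
  simpa using (eq_sum_rightVec_of_inLapLin_eq_zero hG hρ hone v).symm

end RightVec

end WeightedDigraph

/-! ### Spanning trees -/

open Relation in
lemma exists_reflTransGen_first_mem {α : Type*} {r : α → α → Prop} {Z : Set α} {v z : α}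
    (h : ReflTransGen r v z) (hz : z ∈ Z) :
    ∃ w ∈ Z, ReflTransGen (fun a b => a ∉ Z ∧ r a b) v w := by
  induction h using ReflTransGen.head_induction_on with
  | refl => exact ⟨z, hz, .refl⟩
  | @head b c hbc _ ih =>
    by_cases hb : b ∈ Z
    · exact ⟨b, hb, .refl⟩
    · obtain ⟨w, hw, hcw⟩ := ih
      exact ⟨w, hw, hcw.head ⟨hb, hbc⟩⟩

namespace WeightedDigraph

section SpanningTree

open Relation

variable {V : Type*} {G : WeightedDigraph V} {R : Set V} {σ τ : Finset (V × V)} {x y z : V}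

lemma IsSpanningTree.notMem (h : G.IsSpanningTree R z τ) : (z, y) ∉ τ := fun hy => h.root _ hy rfl

lemma IsSpanningTree.acyclic (h : G.IsSpanningTree R z τ) {v : V} (hv : v ∈ R) :
    ¬ TransGen (fun x y => (x, y) ∈ τ) v v := by
  have hvz := h.spanning v hv
  clear hv
  induction hvz using ReflTransGen.head_induction_on with
  | refl =>
    intro hcycle
    obtain ⟨_, hstep, -⟩ := TransGen.head'_iff.1 hcycle
    exact h.notMem hstep
  | @head b c hbc _ ih =>
    intro hcycle
    obtain ⟨d, hbd, hdb⟩ := TransGen.head'_iff.1 hcycle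
    obtain rfl : d = c := congrArg Prod.snd (h.unique_incoming _ hbd _ hbc rfl)
    exact ih (TransGen.tail' hdb hbc)

lemma isSpanningTree_singleton (r : V) : G.IsSpanningTree {r} r ∅ where
  root_mem := rfl
  edge := by simp
  root := by simp
  unique_incoming := by simp
  spanning := by rintro _ rfl; exact .refl

variable [DecidableEq V]

lemma IsSpanningTree.reflTransGen_insert (h : G.IsSpanningTree R z τ) (e : V × V) {v : V}
    (hv : v ∈ R) : ReflTransGen (fun x y => (x, y) ∈ insert e τ) v z :=
  ReflTransGen.mono (fun _ _ => Finset.mem_insert_of_mem) _ _ (h.spanning v hv)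

lemma IsSpanningTree.insert_leaf (h : G.IsSpanningTree R z τ) (hx : x ∉ R) (hy : y ∈ R)
    (hxy : (x, y) ∈ G.E) : G.IsSpanningTree (insert x R) z (insert (x, y) τ) := by
  have hne : ∀ e ∈ τ, e.1 ≠ x := fun e he hex => hx (hex ▸ (h.edge e he).2.1)
  refine ⟨Or.inr h.root_mem, ?_, ?_, ?_, ?_⟩
  · simp only [Finset.forall_mem_insert]
    exact ⟨⟨hxy, Or.inl rfl, Or.inr hy⟩, fun e he =>
      ⟨(h.edge e he).1, Or.inr (h.edge e he).2.1, Or.inr (h.edge e he).2.2⟩⟩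
  · simp only [Finset.forall_mem_insert]
    exact ⟨fun hxz => hx (hxz ▸ h.root_mem), h.root⟩
  · simp only [Finset.forall_mem_insert]
    exact ⟨⟨fun _ => trivial, fun e he hex => absurd hex.symm (hne e he)⟩,
      fun e he => ⟨fun hex => absurd hex (hne e he), h.unique_incoming e he⟩⟩
  · rintro v (rfl | hv)
    · exact .head (Finset.mem_insert_self _ _) (h.reflTransGen_insert _ hy)
    · exact h.reflTransGen_insert _ hv

/-- Edge sets on `R` with unique incoming edges such that every node of `R` is reached from `x`
along a non-trivial path. They are what adding an edge to a spanning tree produces, with `x` on the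
resulting cycle. -/
structure IsUnicyclic (G : WeightedDigraph V) (R : Set V) (x : V) (σ : Finset (V × V)) : Prop where
  mem : x ∈ R
  edge : ∀ e ∈ σ, e ∈ G.E ∧ e.1 ∈ R ∧ e.2 ∈ R
  unique_incoming : ∀ e ∈ σ, ∀ e' ∈ σ, e.1 = e'.1 → e = e'
  spanning : ∀ v ∈ R, TransGen (fun x y => (x, y) ∈ σ) v x

lemma IsUnicyclic.isSpanningTree_erase (h : G.IsUnicyclic R x σ) (hz : (z, y) ∈ σ)
    (hxz : ReflTransGen (fun x y => (x, y) ∈ σ) x z) : G.IsSpanningTree R z (σ.erase (z, y)) where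
  root_mem := (h.edge _ hz).2.1
  edge e he := h.edge e (Finset.mem_of_mem_erase he)
  root e he hez := (Finset.mem_erase.1 he).1
    (h.unique_incoming e (Finset.mem_of_mem_erase he) _ hz hez)
  unique_incoming e he e' he' :=
    h.unique_incoming e (Finset.mem_of_mem_erase he) e' (Finset.mem_of_mem_erase he')
  spanning v hv := by
    obtain ⟨w, rfl, hvw⟩ := exists_reflTransGen_first_mem (Z := {z})
      ((h.spanning v hv).to_reflTransGen.trans hxz) rfl
    refine ReflTransGen.mono (fun a b hab => Finset.mem_erase.2 ⟨?_, hab.2⟩) _ _ hvw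
    exact fun heq => hab.1 (congrArg Prod.fst heq)

lemma IsSpanningTree.isUnicyclic_insert (h : G.IsSpanningTree R z τ) (hzy : (z, y) ∈ G.E)
    (hy : y ∈ R) (hx : x ∈ R) (hzx : TransGen (fun a b => (a, b) ∈ insert (z, y) τ) z x) :
    G.IsUnicyclic R x (insert (z, y) τ) where
  mem := hx
  edge := Finset.forall_mem_insert .. |>.2 ⟨⟨hzy, h.root_mem, hy⟩, h.edge⟩
  unique_incoming := by
    simp only [Finset.forall_mem_insert]
    exact ⟨⟨fun _ => trivial, fun e he hez => absurd hez.symm (h.root e he)⟩,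
      fun e he => ⟨fun hez => absurd hez (h.root e he), h.unique_incoming e he⟩⟩
  spanning _ hv := hzx.trans_right (h.reflTransGen_insert _ hv)

lemma IsSpanningTree.root_eq_of_erase {z' : V} (h : G.IsSpanningTree R z (σ.erase (z, x)))
    (h' : G.IsSpanningTree R z' (σ.erase (z', x))) (hz : (z, x) ∈ σ) (hz' : (z', x) ∈ σ)
    (hx : x ∈ R) : z = z' := by
  by_contra hne
  have hxz : ReflTransGen (fun a b => (a, b) ∈ σ) x z :=
    ReflTransGen.mono (fun _ _ => Finset.mem_of_mem_erase) _ _ (h.spanning x hx)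
  obtain ⟨w, hw, hxw⟩ := exists_reflTransGen_first_mem (Z := {z, z'}) hxz (Or.inl rfl)
  have havoid (u : V) (hu : u ∈ ({z, z'} : Set V)) :
      ReflTransGen (fun a b => (a, b) ∈ σ.erase (u, x)) x w :=
    ReflTransGen.mono (fun a b hab => Finset.mem_erase.2
      ⟨by rintro ⟨⟩; exact hab.1 hu, hab.2⟩) _ _ hxw
  obtain rfl | rfl := hw
  · exact h'.acyclic h.root_mem (TransGen.head'
      (Finset.mem_erase.2 ⟨fun heq => hne (congrArg Prod.fst heq), hz⟩) (havoid z' (Or.inr rfl)))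
  · exact h.acyclic h'.root_mem (TransGen.head'
      (Finset.mem_erase.2 ⟨fun heq => hne (congrArg Prod.fst heq).symm, hz'⟩)
      (havoid z (Or.inl rfl)))

end SpanningTree

section WeightVec

open Relation

variable {V : Type*} [Fintype V] {G : WeightedDigraph V} {R : Set V} {x : V}

open Classical in
lemma sum_weightVec_mul_eq_sum_isUnicyclic {ι : Type*} {s : Finset ι} {e : ι → V × V}
    (hins : ∀ i ∈ s, ∀ τ, G.IsSpanningTree R (e i).1 τ → G.IsUnicyclic R x (insert (e i) τ))
    (herase : ∀ σ, G.IsUnicyclic R x σ →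
      ∃! i, i ∈ s ∧ e i ∈ σ ∧ G.IsSpanningTree R (e i).1 (σ.erase (e i))) :
    ∑ i ∈ s, G.weightVec R (e i).1 * G.a (e i).1 (e i).2 =
      ∑ σ : Finset (V × V) with G.IsUnicyclic R x σ, ∏ d ∈ σ, G.a d.1 d.2 := by
  simp only [weightVec, Finset.sum_mul, Finset.sum_sigma']
  refine Finset.sum_bij (fun p _ => insert (e p.1) p.2) ?_ ?_ ?_ ?_ <;>
    simp only [Finset.mem_sigma, Finset.mem_filter_univ, and_imp, Sigma.forall]
  · exact fun i τ hi hτ => hins i hi τ hτ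
  · intro i τ hi hτ j τ' hj hτ' heq
    have hτi : (insert (e i) τ).erase (e i) = τ := Finset.erase_insert hτ.notMem
    have hτj : (insert (e i) τ).erase (e j) = τ' := heq ▸ Finset.erase_insert hτ'.notMem
    obtain rfl : i = j := (herase _ (hins i hi τ hτ)).unique
      ⟨hi, Finset.mem_insert_self _ _, hτi.symm ▸ hτ⟩
      ⟨hj, heq ▸ Finset.mem_insert_self _ _, hτj.symm ▸ hτ'⟩
    rw [← hτi, ← hτj]
  · intro σ hσ
    obtain ⟨i, ⟨hi, hiσ, htree⟩, -⟩ := herase σ hσ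
    exact ⟨⟨i, σ.erase (e i)⟩, ⟨hi, htree⟩, Finset.insert_erase hiσ⟩
  · intro i τ _ hτ
    rw [Finset.prod_insert hτ.notMem, mul_comm]

open Classical in
lemma weightVec_mul_sum_eq_sum_isUnicyclic (hG : G.IsGraph) (hx : x ∈ R) :
    G.weightVec R x * ∑ y with y ∈ R, G.a x y =
      ∑ σ : Finset (V × V) with G.IsUnicyclic R x σ, ∏ d ∈ σ, G.a d.1 d.2 := by
  have hedges : ∑ y with y ∈ R, G.weightVec R x * G.a x y =
      ∑ y with y ∈ R ∧ (x, y) ∈ G.E, G.weightVec R x * G.a x y := by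
    rw [← Finset.filter_filter]
    refine (Finset.sum_filter_of_ne fun y _ hy => by_contra fun hxy => hy ?_).symm
    rw [hG.a_eq_zero hxy, mul_zero]
  rw [Finset.mul_sum, hedges]
  refine sum_weightVec_mul_eq_sum_isUnicyclic (e := Prod.mk x) ?_ fun σ hσ => ?_ <;>
    simp only [Finset.mem_filter_univ]
  · exact fun y hy τ hτ => hτ.isUnicyclic_insert hy.2 hy.1 hx
      (TransGen.head' (Finset.mem_insert_self _ _) (hτ.reflTransGen_insert _ hy.1))
  · obtain ⟨y, hxy, -⟩ := TransGen.head'_iff.1 (hσ.spanning x hx)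
    exact ⟨y, ⟨⟨(hσ.edge _ hxy).2.2, (hσ.edge _ hxy).1⟩, hxy, hσ.isSpanningTree_erase hxy .refl⟩,
      fun y' hy' => congrArg Prod.snd (hσ.unique_incoming _ hy'.2.1 _ hxy rfl)⟩

open Classical in
lemma sum_weightVec_mul_a_eq_sum_isUnicyclic (hG : G.IsGraph) (hx : x ∈ R) :
    ∑ z with z ∈ R, G.weightVec R z * G.a z x =
      ∑ σ : Finset (V × V) with G.IsUnicyclic R x σ, ∏ d ∈ σ, G.a d.1 d.2 := by
  have hedges : ∑ z with z ∈ R, G.weightVec R z * G.a z x =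
      ∑ z with z ∈ R ∧ (z, x) ∈ G.E, G.weightVec R z * G.a z x := by
    rw [← Finset.filter_filter]
    refine (Finset.sum_filter_of_ne fun z _ hz => by_contra fun hzx => hz ?_).symm
    rw [hG.a_eq_zero hzx, mul_zero]
  rw [hedges]
  refine sum_weightVec_mul_eq_sum_isUnicyclic (e := fun z => (z, x)) ?_ fun σ hσ => ?_ <;>
    simp only [Finset.mem_filter_univ]
  · exact fun z hz τ hτ => hτ.isUnicyclic_insert hz.2 hx hx (.single (Finset.mem_insert_self _ _))
  · obtain ⟨z, hxz, hzx⟩ := TransGen.tail'_iff.1 (hσ.spanning x hx)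
    have htree := hσ.isSpanningTree_erase hzx hxz
    exact ⟨z, ⟨⟨htree.root_mem, (hσ.edge _ hzx).1⟩, hzx, htree⟩,
      fun z' hz' => hz'.2.2.root_eq_of_erase htree hz'.2.1 hzx hx⟩

open Classical in
/-- The Markov chain tree theorem. Adding an edge which enters `x` to a tree rooted at `x`, or an
edge which leaves `x` to any tree, produces each unicyclic edge set through `x` exactly once. -/
theorem weightVec_mul_sum_of_mem (hG : G.IsGraph) (hx : x ∈ R) :
    G.weightVec R x * ∑ y with y ∈ R, G.a x y = ∑ z with z ∈ R, G.weightVec R z * G.a z x :=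
  (weightVec_mul_sum_eq_sum_isUnicyclic hG hx).trans
    (sum_weightVec_mul_a_eq_sum_isUnicyclic hG hx).symm

lemma weightVec_nonneg (hG : G.IsGraph) (R : Set V) (i : V) : 0 ≤ G.weightVec R i :=
  Finset.sum_nonneg fun _ _ => Finset.prod_nonneg fun e _ => hG.a_nonneg e.1 e.2

end WeightVec

section LeftVec

variable {V : Type*} {G : WeightedDigraph V} {R : G.Reach} {r x z : V}

lemma IsSpanningTree.isRoot {τ : Finset (V × V)} (h : G.IsSpanningTree R.1 z τ) (hG : G.IsGraph) :
    IsRoot R z :=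
  isRoot_of_forall_sees R fun v hv => Relation.ReflTransGen.mono
    (fun x y hxy => ⟨(h.edge _ hxy).1, ((hG.mem_E x y).1 (h.edge _ hxy).1).ne'⟩) _ _
    (h.spanning v hv)

lemma exists_isSpanningTree [Finite V] (r : V) : ∃ τ, G.IsSpanningTree (G.reachableSet r) r τ := by
  classical
  obtain ⟨S, -, ⟨hSr, τ, hτ⟩, hmax⟩ :=
    (Set.toFinite {S | S ⊆ G.reachableSet r ∧ ∃ τ, G.IsSpanningTree S r τ}).exists_le_maximal
      (a := {r}) ⟨by rintro _ rfl; exact Sees.refl _, ∅, isSpanningTree_singleton r⟩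
  suffices hS : G.reachableSet r ⊆ S from hS.antisymm hSr ▸ ⟨τ, hτ⟩
  intro v hv
  by_contra hvS
  obtain ⟨y, hy, hvy⟩ := exists_reflTransGen_first_mem hv hτ.root_mem
  obtain rfl | ⟨x, -, hx, hxy⟩ := hvy.cases_tail
  · exact hvS hy
  · have hxr : G.Sees x r := Sees.trans (.single hxy) (hSr hy)
    exact hx (hmax ⟨Set.insert_subset hxr hSr, _, hτ.insert_leaf hx hy hxy.1⟩
      (Set.subset_insert x S) (Set.mem_insert x S))

variable [Fintype V]

lemma weightVec_eq_zero (hG : G.IsGraph) (h : ¬ IsRoot R z) : G.weightVec R.1 z = 0 := by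
  classical
  exact Finset.sum_eq_zero fun τ hτ => absurd (((Finset.mem_filter_univ τ).1 hτ).isRoot hG) h

lemma weightVec_pos (hG : G.IsGraph) (hr : IsRoot R r) : 0 < G.weightVec R.1 r := by
  classical
  obtain ⟨τ, hτ⟩ := exists_isSpanningTree (G := G) r
  exact Finset.sum_pos' (fun _ _ => Finset.prod_nonneg fun e _ => hG.a_nonneg e.1 e.2)
    ⟨τ, (Finset.mem_filter_univ τ).2 (hr ▸ hτ),
      Finset.prod_pos fun e he => (hG.mem_E e.1 e.2).1 (hτ.edge e he).1⟩

lemma weightVec_mul_a_eq_zero (hG : G.IsGraph) (z : V) (hx : x ∉ R.1) :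
    G.weightVec R.1 z * G.a z x = 0 := by
  by_cases hz : IsRoot R z
  · rw [hG.a_eq_zero fun hzx => hx (hz.of_sees (hG.sees_of_mem hzx)).mem, mul_zero]
  · rw [weightVec_eq_zero hG hz, zero_mul]

theorem weightVec_mul_inDegree (hG : G.IsGraph) (R : G.Reach) (x : V) :
    G.weightVec R.1 x * G.inDegree x = ∑ z, G.weightVec R.1 z * G.a z x := by
  classical
  by_cases hx : x ∈ R.1
  · have hin : G.weightVec R.1 x * G.inDegree x =
        G.weightVec R.1 x * ∑ y with y ∈ R.1, G.a x y := by
      simp only [inDegree, Finset.mul_sum]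
      exact (Finset.sum_filter_of_ne fun y _ hy =>
        not_imp_comm.1 (weightVec_mul_a_eq_zero hG x) hy).symm
    rw [hin, weightVec_mul_sum_of_mem hG hx]
    refine Finset.sum_filter_of_ne fun z _ hz => by_contra fun hzR => hz ?_
    rw [weightVec_eq_zero hG fun hroot => hzR hroot.mem, zero_mul]
  · simp only [weightVec_eq_zero hG fun hroot => hx hroot.mem, zero_mul,
      weightVec_mul_a_eq_zero hG _ hx, Finset.sum_const_zero]

lemma sum_weightVec_mul_mass_pos (hG : G.IsGraph) (R : G.Reach) :
    0 < ∑ i, G.weightVec R.1 i * G.m i := by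
  obtain ⟨r, hr⟩ := exists_isRoot R
  exact Finset.sum_pos' (fun i _ => mul_nonneg (weightVec_nonneg hG _ i) (hG.m_pos i).le)
    ⟨r, Finset.mem_univ r, mul_pos (weightVec_pos hG hr) (hG.m_pos r)⟩

lemma leftVec_nonneg (hG : G.IsGraph) (R : G.Reach) (x : V) : 0 ≤ G.leftVec R x :=
  div_nonneg (weightVec_nonneg hG _ x) (sum_weightVec_mul_mass_pos hG R).le

lemma leftVec_eq_zero (hG : G.IsGraph) (h : ¬ IsRoot R x) : G.leftVec R x = 0 := by
  rw [leftVec, weightVec_eq_zero hG h, zero_div]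

lemma sum_leftVec_mul_mass (hG : G.IsGraph) (R : G.Reach) : ∑ x, G.leftVec R x * G.m x = 1 := by
  simp only [leftVec, div_mul_eq_mul_div, ← Finset.sum_div]
  exact div_self (sum_weightVec_mul_mass_pos hG R).ne'

lemma leftVec_mul_inDegree (hG : G.IsGraph) (R : G.Reach) (x : V) :
    G.leftVec R x * G.inDegree x = ∑ z, G.leftVec R z * G.a z x := by
  simp only [leftVec, div_mul_eq_mul_div, ← Finset.sum_div, weightVec_mul_inDegree hG]

end LeftVec

end WeightedDigraph

/-! ### Semigroups with uniformizable generators -/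

section Semigroup

open Filter Topology NormedSpace
open scoped Nat

variable {𝔸 : Type*} [NormedRing 𝔸] [NormedAlgebra ℝ 𝔸]

lemma norm_smul_one_sub_add_smul_le {A B : 𝔸} {a b β : ℝ} (hA : ‖a • 1 - A‖ ≤ a)
    (hB : ‖b • 1 - B‖ ≤ b) (hβ : 0 ≤ β) :
    ‖(a + β * b) • 1 - (A + β • B)‖ ≤ a + β * b := by
  have hsplit : (a + β * b) • 1 - (A + β • B) = (a • 1 - A) + β • (b • 1 - B) := by module
  rw [hsplit]
  refine norm_add_le_of_le hA ?_
  rw [norm_smul, Real.norm_of_nonneg hβ]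
  gcongr

variable [CompleteSpace 𝔸]

lemma hasSum_descFactorial_div_factorial_smul_pow (x : 𝔸) (k : ℕ) :
    HasSum (fun n : ℕ => ((n.descFactorial k : ℝ) / n !) • x ^ n) (x ^ k * exp x) := by
  have hhead : ∑ n ∈ Finset.range k, ((n.descFactorial k : ℝ) / n !) • x ^ n = 0 :=
    Finset.sum_eq_zero fun n hn => by
      rw [Nat.descFactorial_of_lt (Finset.mem_range.1 hn), Nat.cast_zero, zero_div, zero_smul]
  rw [← hasSum_nat_add_iff' k, hhead, sub_zero]
  refine (congrArg (HasSum · _) (funext fun n => ?_)).mpr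
    ((exp_series_hasSum_exp' (𝕂 := ℝ) x).mul_left (x ^ k))
  have hfact : (((n + k)! : ℕ) : ℝ) = n ! * (n + k).descFactorial k := by
    rw [← Nat.factorial_mul_descFactorial (Nat.le_add_left k n), Nat.add_sub_cancel, Nat.cast_mul]
  have hdesc : ((n + k).descFactorial k : ℝ) ≠ 0 :=
    Nat.cast_ne_zero.2 (Nat.descFactorial_pos.2 (Nat.le_add_left k n)).ne'
  rw [mul_smul_comm, ← pow_add, add_comm k n, hfact, div_mul_cancel_right₀ hdesc]

lemma hasSum_sub_sq_mul_pow_div_factorial (l : ℝ) :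
    HasSum (fun n : ℕ => (n - l) ^ 2 * (l ^ n / n !)) (l * Real.exp l) := by
  have hmoment (k : ℕ) := hasSum_descFactorial_div_factorial_smul_pow l k
  have hvalue : l * Real.exp l =
      l ^ 2 * exp l + (1 - 2 * l) * (l ^ 1 * exp l) + l ^ 2 * (l ^ 0 * exp l) := by
    rw [Real.exp_eq_exp_ℝ]
    ring
  rw [hvalue]
  refine (congrArg (HasSum · _) (funext fun n => ?_)).mpr
    (((hmoment 2).add ((hmoment 1).mul_left (1 - 2 * l))).add ((hmoment 0).mul_left (l ^ 2)))
  simp only [Nat.cast_descFactorial_two, Nat.descFactorial_one, Nat.descFactorial_zero,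
    Nat.cast_one, smul_eq_mul]
  ring

lemma hasSum_sub_div_factorial_smul_pow (x : 𝔸) (l : ℝ) :
    HasSum (fun n : ℕ => ((l - n) / n !) • x ^ n) (exp x * (l • 1 - x)) := by
  have hvalue : exp x * (l • 1 - x) = l • (x ^ 0 * exp x) - x ^ 1 * exp x := by
    rw [mul_sub, mul_smul_comm, mul_one, pow_zero, one_mul, pow_one,
      (Commute.refl x).exp_right.eq]
  rw [hvalue]
  refine (congrArg (HasSum · _) (funext fun n => ?_)).mpr
    (((hasSum_descFactorial_div_factorial_smul_pow x 0).const_smul l).sub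
      (hasSum_descFactorial_div_factorial_smul_pow x 1))
  rw [Nat.descFactorial_zero, Nat.descFactorial_one, Nat.cast_one, smul_smul, ← sub_smul,
    mul_one_div, sub_div]

lemma norm_exp_mul_smul_one_sub_le [NormOneClass 𝔸] {l : ℝ} {x : 𝔸} (hx : ‖x‖ ≤ l) :
    ‖exp x * (l • 1 - x)‖ ≤ √l * Real.exp l := by
  obtain rfl | hl := ((norm_nonneg x).trans hx).eq_or_lt
  · rw [norm_le_zero_iff.1 hx]
    simp
  have hbound : HasSum
      (fun n : ℕ => √l / 2 * (l ^ n / n !) + (2 * √l)⁻¹ * ((n - l) ^ 2 * (l ^ n / n !)))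
      (√l * Real.exp l) := by
    have hvalue : √l * Real.exp l = √l / 2 * exp l + (2 * √l)⁻¹ * (l * Real.exp l) := by
      have hsqrt : (√l)⁻¹ * l = √l := by rw [inv_mul_eq_div, Real.div_sqrt]
      rw [← Real.exp_eq_exp_ℝ, mul_inv, mul_assoc, ← mul_assoc (√l)⁻¹, hsqrt]
      ring
    rw [hvalue]
    exact ((expSeries_div_hasSum_exp l).mul_left (√l / 2)).add
      ((hasSum_sub_sq_mul_pow_div_factorial l).mul_left (2 * √l)⁻¹)
  refine (hasSum_sub_div_factorial_smul_pow x l).norm_le_of_bounded hbound fun n => ?_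
  have hterm : ‖((l - n) / n !) • x ^ n‖ ≤ |l - n| * (l ^ n / n !) := by
    rw [norm_smul, Real.norm_eq_abs, abs_div, Nat.abs_cast, div_mul_eq_mul_div, ← mul_div_assoc]
    gcongr
    exact (norm_pow_le x n).trans (by gcongr)
  -- AM-GM
  have habs : |l - n| ≤ √l / 2 + (2 * √l)⁻¹ * (n - l) ^ 2 := by
    have hsqrt := Real.sqrt_pos.2 hl
    rw [abs_sub_comm, ← sq_abs ((n : ℝ) - l)]
    field_simp
    linarith [two_mul_le_add_sq (√l) |(n : ℝ) - l|]
  calc ‖((l - n) / n !) • x ^ n‖ ≤ |l - n| * (l ^ n / n !) := hterm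
    _ ≤ (√l / 2 + (2 * √l)⁻¹ * (n - l) ^ 2) * (l ^ n / n !) := by gcongr
    _ = _ := by ring

lemma norm_exp_le_exp_norm [NormOneClass 𝔸] (x : 𝔸) : ‖exp x‖ ≤ Real.exp ‖x‖ := by
  refine (exp_series_hasSum_exp' (𝕂 := ℝ) x).norm_le_of_bounded
    (Real.exp_eq_exp_ℝ ▸ expSeries_div_hasSum_exp ‖x‖) fun n => ?_
  rw [norm_smul, norm_inv, Real.norm_natCast, inv_mul_eq_div]
  gcongr
  exact norm_pow_le x n

lemma exp_neg_smul_eq_smul_exp (L : 𝔸) (c t : ℝ) :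
    exp (-t • L) = Real.exp (-(t * c)) • exp (t • (c • 1 - L)) := by
  let _ : NormedAlgebra ℚ 𝔸 := NormedAlgebra.restrictScalars ℚ ℝ 𝔸
  have hsplit : -t • L = algebraMap ℝ 𝔸 (-(t * c)) + t • (c • 1 - L) := by
    rw [Algebra.algebraMap_eq_smul_one]
    module
  rw [hsplit, exp_add_of_commute (Algebra.commutes _ _), ← algebraMap_exp_comm,
    ← Real.exp_eq_exp_ℝ, ← Algebra.smul_def]

variable [NormOneClass 𝔸] {L : 𝔸} {c t : ℝ}

lemma norm_exp_neg_smul_le_one (hL : ‖c • 1 - L‖ ≤ c) (ht : 0 ≤ t) : ‖exp (-t • L)‖ ≤ 1 := by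
  rw [exp_neg_smul_eq_smul_exp L c, norm_smul, Real.norm_eq_abs, Real.abs_exp]
  calc Real.exp (-(t * c)) * ‖exp (t • (c • 1 - L))‖
      ≤ Real.exp (-(t * c)) * Real.exp (t * c) := by
        gcongr
        refine (norm_exp_le_exp_norm _).trans (Real.exp_le_exp.2 ?_)
        rw [norm_smul, Real.norm_of_nonneg ht]
        gcongr
    _ = 1 := by rw [← Real.exp_add, neg_add_cancel, Real.exp_zero]

lemma norm_exp_neg_smul_mul_self_le (hL : ‖c • 1 - L‖ ≤ c) (ht : 0 < t) :
    ‖exp (-t • L) * L‖ ≤ √(c / t) := by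
  set M := t • (c • 1 - L) with hM_def
  have hM : ‖M‖ ≤ t * c := by
    rw [norm_smul, Real.norm_of_nonneg ht.le]
    gcongr
  have hL' : L = t⁻¹ • ((t * c) • 1 - M) := by
    rw [hM_def, ← smul_smul, ← smul_sub, sub_sub_cancel, inv_smul_smul₀ ht.ne']
  have hfactor : exp (-t • L) * L =
      (Real.exp (-(t * c)) * t⁻¹) • (exp M * ((t * c) • 1 - M)) :=
    (congrArg₂ (· * ·) (exp_neg_smul_eq_smul_exp L c t) hL').trans (smul_mul_smul_comm ..)
  calc ‖exp (-t • L) * L‖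
      = Real.exp (-(t * c)) * (t⁻¹ * ‖exp M * ((t * c) • 1 - M)‖) := by
        rw [hfactor, norm_smul, norm_mul, norm_inv, Real.norm_of_nonneg ht.le, Real.norm_eq_abs,
          Real.abs_exp, mul_assoc]
    _ ≤ Real.exp (-(t * c)) * (t⁻¹ * (√(t * c) * Real.exp (t * c))) := by
        gcongr
        exact norm_exp_mul_smul_one_sub_le hM
    _ = t⁻¹ * √(t * c) := by
        rw [mul_left_comm, mul_left_comm (Real.exp _), ← Real.exp_add, neg_add_cancel,
          Real.exp_zero, mul_one]
    _ = √(c / t) := by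
        rw [← Real.sqrt_sq (inv_nonneg.2 ht.le), ← Real.sqrt_mul (sq_nonneg _)]
        congr 1
        field_simp

lemma norm_exp_neg_smul_mul_sub_mul_exp_le (hL : ‖c • 1 - L‖ ≤ c) (N W : 𝔸) (ht : 0 ≤ t) :
    ‖exp (-t • L) * W - W * exp (-t • N)‖ ≤ ‖L * W - W * N‖ * Real.exp (t * ‖N‖) * t := by
  -- Duhamel: `u` joins the two terms of the difference.
  set u : ℝ → 𝔸 := fun s => exp ((s - t) • L) * W * exp (s • -N) with hu
  have hderiv (s : ℝ) :
      HasDerivAt u (exp ((s - t) • L) * (L * W - W * N) * exp (s • -N)) s := by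
    have hleft : HasDerivAt (fun s : ℝ => exp ((s - t) • L)) (exp ((s - t) • L) * L) s := by
      simpa using (hasDerivAt_exp_smul_const L (s - t)).comp_sub_const s t
    refine ((hleft.mul_const W).mul (hasDerivAt_exp_smul_const' (-N) s)).congr_deriv ?_
    simp only [mul_sub, sub_mul, neg_mul, mul_neg, mul_assoc, ← sub_eq_add_neg]
  have hbound (s : ℝ) (hs : s ∈ Set.Ico 0 t) :
      ‖exp ((s - t) • L) * (L * W - W * N) * exp (s • -N)‖ ≤
        ‖L * W - W * N‖ * Real.exp (t * ‖N‖) := by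
    have hexpL : ‖exp ((s - t) • L)‖ ≤ 1 := by
      simpa using norm_exp_neg_smul_le_one hL (sub_nonneg.2 hs.2.le)
    have hexpN : ‖exp (s • -N)‖ ≤ Real.exp (t * ‖N‖) := by
      refine (norm_exp_le_exp_norm _).trans (Real.exp_le_exp.2 ?_)
      rw [norm_smul, norm_neg, Real.norm_of_nonneg hs.1]
      gcongr
      exact hs.2.le
    calc _ ≤ ‖exp ((s - t) • L)‖ * ‖L * W - W * N‖ * ‖exp (s • -N)‖ := norm_mul₃_le
      _ ≤ 1 * ‖L * W - W * N‖ * Real.exp (t * ‖N‖) := by gcongr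
      _ = _ := by rw [one_mul]
  have hmvt := norm_image_sub_le_of_norm_deriv_le_segment'
    (fun s _ => (hderiv s).hasDerivWithinAt) hbound t (Set.right_mem_Icc.2 ht)
  rw [norm_sub_rev, sub_zero] at hmvt
  simpa [hu] using hmvt

variable {A B P X S N : 𝔸} {a b β : ℝ}

lemma norm_exp_neg_smul_add_smul_mul_le (hA : ‖a • 1 - A‖ ≤ a) (hB : ‖b • 1 - B‖ ≤ b)
    (ht : 0 < t) (hβ : 1 ≤ β) :
    ‖exp (-t • (A + β • B)) * B‖ ≤ (√((a + b) / t) + ‖A‖) / √β := by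
  have hβ0 : 0 < β := one_pos.trans_le hβ
  have ha : 0 ≤ a := (norm_nonneg _).trans hA
  have hsqrtβ : 1 ≤ √β := Real.one_le_sqrt.2 hβ
  set L := A + β • B with hL_def
  have hL := norm_smul_one_sub_add_smul_le hA hB hβ0.le
  have hB_eq : exp (-t • L) * B = β⁻¹ • (exp (-t • L) * L - exp (-t • L) * A) := by
    rw [← mul_sub, hL_def, add_sub_cancel_left, mul_smul_comm, inv_smul_smul₀ hβ0.ne']
  have hexpL : ‖exp (-t • L) * L‖ ≤ √β * √((a + b) / t) := by
    rw [← Real.sqrt_mul hβ0.le, ← mul_div_assoc]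
    refine (norm_exp_neg_smul_mul_self_le hL ht).trans ?_
    gcongr
    linarith [le_mul_of_one_le_left ha hβ]
  have hexpA : ‖exp (-t • L) * A‖ ≤ √β * ‖A‖ :=
    (norm_mul_le _ _).trans (by gcongr; exact (norm_exp_neg_smul_le_one hL ht.le).trans hsqrtβ)
  calc ‖exp (-t • L) * B‖ = β⁻¹ * ‖exp (-t • L) * L - exp (-t • L) * A‖ := by
        rw [hB_eq, norm_smul, norm_inv, Real.norm_of_nonneg hβ0.le]
    _ ≤ β⁻¹ * (√β * √((a + b) / t) + √β * ‖A‖) := by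
        gcongr
        exact norm_sub_le_of_le hexpL hexpA
    _ = (√((a + b) / t) + ‖A‖) / √β := by
        rw [← mul_add, ← mul_assoc, inv_mul_eq_div, Real.sqrt_div_self', one_div_mul_eq_div]

lemma norm_exp_neg_smul_add_smul_mul_sub_le (hA : ‖a • 1 - A‖ ≤ a) (hB : ‖b • 1 - B‖ ≤ b)
    (ht : 0 ≤ t) (hβ : 0 < β) (hBP : B * P = 0) (hBX : B * X = A * P - P * N) :
    ‖exp (-t • (A + β • B)) * P - P * exp (-t • N)‖ ≤
      (‖X * N - A * X‖ * Real.exp (t * ‖N‖) * t + (‖X‖ + ‖X * exp (-t • N)‖)) / β := by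
  set L := A + β • B with hL_def
  have hL := norm_smul_one_sub_add_smul_le hA hB hβ.le
  -- The corrector `X` makes `P - β⁻¹ • X` intertwine `L` and `N` up to an error of order `β⁻¹`.
  have hdefect : L * (P - β⁻¹ • X) - (P - β⁻¹ • X) * N = β⁻¹ • (X * N - A * X) := by
    have hBX' : (β • B) * (P - β⁻¹ • X) = P * N - A * P := by
      rw [mul_sub, smul_mul_assoc, hBP, smul_zero, zero_sub, smul_mul_smul_comm,
        mul_inv_cancel₀ hβ.ne', one_smul, hBX, neg_sub]
    rw [hL_def, add_mul, hBX', mul_sub, sub_mul, mul_smul_comm, smul_mul_assoc, smul_sub]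
    abel
  have hsplit : exp (-t • L) * P - P * exp (-t • N) =
      (exp (-t • L) * (P - β⁻¹ • X) - (P - β⁻¹ • X) * exp (-t • N)) +
        β⁻¹ • (exp (-t • L) * X - X * exp (-t • N)) := by
    rw [mul_sub, sub_mul, mul_smul_comm, smul_mul_assoc, smul_sub]
    abel
  have hmain := norm_exp_neg_smul_mul_sub_mul_exp_le hL N (P - β⁻¹ • X) ht
  have hexpX : ‖exp (-t • L) * X‖ ≤ ‖X‖ :=
    (norm_mul_le _ _).trans
      (mul_le_of_le_one_left (norm_nonneg X) (norm_exp_neg_smul_le_one hL ht))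
  have hnorm (x : 𝔸) : ‖β⁻¹ • x‖ = β⁻¹ * ‖x‖ := by
    rw [norm_smul, norm_inv, Real.norm_of_nonneg hβ.le]
  rw [hdefect, hnorm] at hmain
  calc ‖exp (-t • L) * P - P * exp (-t • N)‖
      ≤ β⁻¹ * ‖X * N - A * X‖ * Real.exp (t * ‖N‖) * t +
          β⁻¹ * (‖X‖ + ‖X * exp (-t • N)‖) := by
        rw [hsplit]
        refine norm_add_le_of_le hmain ?_
        rw [hnorm]
        gcongr
        exact norm_sub_le_of_le hexpX le_rfl
    _ = _ := by ring

theorem tendsto_exp_neg_smul_add_smul (hA : ‖a • 1 - A‖ ≤ a) (hB : ‖b • 1 - B‖ ≤ b) (ht : 0 < t)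
    (hBP : B * P = 0) (hBS : B * S = 1 - P) :
    Tendsto (fun β : ℝ => exp (-t • (A + β • B))) atTop (𝓝 (P * exp (-t • (A * P)))) := by
  set N := A * P
  set X := S * N with hX
  have hBX : B * X = A * P - P * N := by rw [hX, ← mul_assoc, hBS, sub_mul, one_mul]
  have hsplit (β : ℝ) : exp (-t • (A + β • B)) - P * exp (-t • N) =
      (exp (-t • (A + β • B)) * P - P * exp (-t • N)) + exp (-t • (A + β • B)) * B * S := by
    rw [mul_assoc, hBS, mul_sub, mul_one]
    abel
  set C := ‖X * N - A * X‖ * Real.exp (t * ‖N‖) * t + (‖X‖ + ‖X * exp (-t • N)‖)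
  set D := √((a + b) / t) + ‖A‖
  have hzero : Tendsto (fun β : ℝ => C / β + D / √β * ‖S‖) atTop (𝓝 0) := by
    simpa using (tendsto_const_nhds.div_atTop tendsto_id).add
      ((tendsto_const_nhds.div_atTop Real.tendsto_sqrt_atTop).mul_const ‖S‖)
  rw [tendsto_iff_norm_sub_tendsto_zero]
  refine squeeze_zero' (.of_forall fun _ => norm_nonneg _) ?_ hzero
  filter_upwards [eventually_ge_atTop 1] with β hβ
  rw [hsplit]
  refine norm_add_le_of_le
    (norm_exp_neg_smul_add_smul_mul_sub_le hA hB ht.le (one_pos.trans_le hβ) hBP hBX) ?_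
  refine (norm_mul_le _ _).trans ?_
  gcongr
  exact norm_exp_neg_smul_add_smul_mul_le hA hB ht hβ

end Semigroup

section Intertwining

open NormedSpace

variable {𝕜 E E' : Type*} [RCLike 𝕜] [NormedAddCommGroup E] [NormedSpace 𝕜 E] [CompleteSpace E]
  [NormedAddCommGroup E'] [NormedSpace 𝕜 E'] [CompleteSpace E']

lemma comp_exp_eq_exp_comp {U : E →L[𝕜] E'} {X : E →L[𝕜] E} {Y : E' →L[𝕜] E'}
    (h : U ∘L X = Y ∘L U) : U ∘L exp X = exp Y ∘L U := by
  have hpow (n : ℕ) : U ∘L (X ^ n) = (Y ^ n) ∘L U := by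
    induction n with
    | zero => rfl
    | succ n ih =>
      calc U ∘L (X ^ (n + 1)) = (U ∘L (X ^ n)) ∘L X := by rw [pow_succ]; rfl
        _ = (Y ^ n) ∘L (U ∘L X) := by rw [ih]; rfl
        _ = (Y ^ (n + 1)) ∘L U := by rw [h, pow_succ]; rfl
  have hX := (ContinuousLinearMap.compL 𝕜 E E E' U).hasSum (exp_series_hasSum_exp' (𝕂 := 𝕜) X)
  have hY := ((ContinuousLinearMap.compL 𝕜 E E' E').flip U).hasSum
    (exp_series_hasSum_exp' (𝕂 := 𝕜) Y)
  refine hX.unique ((congrArg (HasSum · _) (funext fun n => ?_)).mpr hY)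
  simp only [map_smul, ContinuousLinearMap.compL_apply, ContinuousLinearMap.flip_apply, hpow]

end Intertwining

/-! ### The Riesz projection onto a semisimple eigenvalue -/

/-- `P` is the projection onto the kernel of `L` along the range of `L`. Invertibility of `L + P`
expresses that kernel and range are complementary, that is, that `0` is a semisimple point of the
spectrum of `L` (or no point of it at all, in which case `P = 0`). -/
structure IsKernelProjection {𝔸 : Type*} [Ring 𝔸] (L P : 𝔸) : Prop where
  mul_proj : L * P = 0
  proj_mul : P * L = 0
  isIdempotentElem : IsIdempotentElem P
  isUnit_add : IsUnit (L + P)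

namespace IsKernelProjection

open Filter Topology

section Ring

variable {𝔸 : Type*} [Ring 𝔸] {L P : 𝔸}

lemma exists_mul_eq_one_sub (h : IsKernelProjection L P) : ∃ S, L * S = 1 - P := by
  obtain ⟨u, hu⟩ := h.isUnit_add
  have hproj : P * ↑u⁻¹ = P := (Units.mul_inv_eq_iff_eq_mul u).2 <| by
    rw [hu, mul_add, h.proj_mul, h.isIdempotentElem.eq, zero_add]
  exact ⟨↑u⁻¹, by rw [eq_sub_of_add_eq hu.symm, sub_mul, u.mul_inv, hproj]⟩

lemma resolvent_eq {𝕜 : Type*} [Field 𝕜] [Algebra 𝕜 𝔸] (h : IsKernelProjection L P) {z : 𝕜}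
    (hz : z ≠ 0) (hzLP : z ∈ resolventSet 𝕜 (L + P)) :
    resolvent L z = z⁻¹ • P + resolvent (L + P) z * (1 - P) := by
  obtain ⟨u, hu⟩ := hzLP
  have hr : resolvent (L + P) z = ↑u⁻¹ := by rw [resolvent, ← hu, Ring.inverse_unit]
  set w := algebraMap 𝕜 𝔸 z - L with hw
  have hwu : w = u + P := by rw [hu, hw]; abel
  have hwP : w * P = z • P := by rw [hw, sub_mul, h.mul_proj, sub_zero, ← Algebra.smul_def]
  have hcommP : Commute w P :=
    (Algebra.commute_algebraMap_left z P).sub_left (h.mul_proj.trans h.proj_mul.symm)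
  have hPu : Commute P ↑u⁻¹ :=
    Commute.units_inv_right (eq_sub_of_add_eq hwu.symm ▸ hcommP.symm.sub_right (.refl P))
  have hcommu : Commute w ↑u⁻¹ :=
    hwu ▸ (Commute.units_inv_right (.refl (u : 𝔸))).add_left hPu
  have hPQ : P * (1 - P) = 0 := by rw [mul_sub, mul_one, h.isIdempotentElem.eq, sub_self]
  have hmul : w * (z⁻¹ • P + ↑u⁻¹ * (1 - P)) = 1 := by
    calc w * (z⁻¹ • P + ↑u⁻¹ * (1 - P))
        = P + (u + P) * ↑u⁻¹ * (1 - P) := by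
          rw [mul_add, mul_smul_comm, hwP, inv_smul_smul₀ hz, hwu, mul_assoc]
      _ = P + (1 - P) := by
          rw [add_mul, u.mul_inv, hPu.eq, add_mul, one_mul, mul_assoc, hPQ, mul_zero, add_zero]
      _ = 1 := add_sub_cancel P 1
  have hcomm : Commute w (z⁻¹ • P + ↑u⁻¹ * (1 - P)) :=
    (hcommP.smul_right _).add_right
      (hcommu.mul_right ((Commute.one_right w).sub_right hcommP))
  rw [hr]
  exact Ring.inverse_unit ⟨w, _, hmul, hcomm.eq ▸ hmul⟩

end Ring

lemma eventually_circleIntegral_resolvent {𝔸 : Type*} [NormedRing 𝔸] [NormedAlgebra ℂ 𝔸]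
    [CompleteSpace 𝔸] {L P : 𝔸} (h : IsKernelProjection L P) :
    ∀ᶠ ε in 𝓝[>] (0 : ℝ), ∮ z in C(0, ε), resolvent L z = (2 * Real.pi * Complex.I : ℂ) • P := by
  have hzero_mem : (0 : ℂ) ∈ resolventSet ℂ (L + P) := by
    rw [spectrum.mem_resolventSet_iff, map_zero, zero_sub]
    exact h.isUnit_add.neg
  obtain ⟨δ, hδ, hball⟩ :=
    Metric.isOpen_iff.1 (spectrum.isOpen_resolventSet (𝕜 := ℂ) (L + P)) 0 hzero_mem
  filter_upwards [Ioo_mem_nhdsGT hδ] with ε ⟨hε, hεδ⟩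
  have hsub : Metric.closedBall (0 : ℂ) ε ⊆ resolventSet ℂ (L + P) :=
    (Metric.closedBall_subset_ball hεδ).trans hball
  have hne {z : ℂ} (hz : z ∈ Metric.sphere (0 : ℂ) ε) : z ≠ 0 := Metric.ne_of_mem_sphere hz hε.ne'
  have hdiff : DifferentiableOn ℂ (fun z => resolvent (L + P) z * (1 - P))
      (Metric.closedBall (0 : ℂ) ε) := fun z hz =>
    ((spectrum.hasDerivAt_resolvent_const_left (hsub hz)).mul_const
      (1 - P)).differentiableAt.differentiableWithinAt
  have hregular : ∮ z in C(0, ε), resolvent (L + P) z * (1 - P) = 0 := by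
    refine DiffContOnCl.circleIntegral_eq_zero hε.le (DifferentiableOn.diffContOnCl ?_)
    rwa [closure_ball _ hε.ne']
  have hpole : ContinuousOn (fun z : ℂ => (z - 0)⁻¹ • P) (Metric.sphere 0 ε) :=
    ((continuousOn_id.sub continuousOn_const).inv₀ fun z hz =>
      sub_ne_zero.2 (hne hz)).smul continuousOn_const
  calc ∮ z in C(0, ε), resolvent L z
      = ∮ z in C(0, ε), ((z - 0)⁻¹ • P + resolvent (L + P) z * (1 - P)) :=
        circleIntegral.integral_congr hε.le fun z hz => by
          rw [sub_zero, h.resolvent_eq (hne hz) (hsub (Metric.sphere_subset_closedBall hz))]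
    _ = (∮ z in C(0, ε), (z - 0)⁻¹) • P := by
        rw [circleIntegral.integral_add (hpole.circleIntegrable hε.le)
          ((hdiff.continuousOn.mono Metric.sphere_subset_closedBall).circleIntegrable hε.le),
          hregular, add_zero, circleIntegral.integral_smul_const]
    _ = _ := by rw [circleIntegral.integral_sub_center_inv _ hε.ne']

lemma rieszProj_eq {V : Type*} [Fintype V] {L P : (V → ℂ) →L[ℂ] (V → ℂ)}
    (h : IsKernelProjection L P) : WeightedDigraph.rieszProj L = P := by
  refine Tendsto.limUnder_eq (tendsto_nhds_of_eventually_eq ?_)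
  filter_upwards [h.eventually_circleIntegral_resolvent] with ε hε
  rw [WeightedDigraph.rieszIntegral, hε, inv_smul_smul₀ Complex.two_pi_I_ne_zero]

end IsKernelProjection

namespace WeightedDigraph

variable {V : Type*} [Fintype V] {G : WeightedDigraph V} {F : Set (V × V)}

/-! ### The projection of functions to the reaches and their interpolation -/

lemma Jdown_apply (f : V → ℂ) (R : (G.restrict F).Reach) :
    G.Jdown F f R = ∑ x, ((G.restrict F).leftVec R x : ℂ) * f x * (G.m x : ℂ) := by
  change ∑ x, _ = _
  simp only [Complex.conj_ofReal]

lemma Jup_apply (g : (G.restrict F).Reach → ℂ) (v : V) :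
    G.Jup F g v = ∑ R, g R * ((G.restrict F).rightVec R v : ℂ) := rfl

lemma Jup_apply_of_isRoot {R : (G.restrict F).Reach} {r : V} (hr : IsRoot R r)
    (g : (G.restrict F).Reach → ℂ) : G.Jup F g r = g R := by
  classical
  simp [Jup_apply, rightVec_of_isRoot hr, apply_ite]

lemma leftVec_mul_congr (hG : G.IsGraph) {R : G.Reach} {f g : V → ℂ}
    (hfg : ∀ r, IsRoot R r → f r = g r) (x : V) :
    (G.leftVec R x : ℂ) * f x = (G.leftVec R x : ℂ) * g x := by
  by_cases hx : IsRoot R x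
  · rw [hfg x hx]
  · rw [leftVec_eq_zero hG hx, Complex.ofReal_zero, zero_mul, zero_mul]

lemma Jdown_eq_of_forall_isRoot (hG : G.IsGraph) {R : (G.restrict F).Reach} {f : V → ℂ} {z : ℂ}
    (hf : ∀ r, IsRoot R r → f r = z) : G.Jdown F f R = z := by
  have hmass : ∑ x, ((G.restrict F).leftVec R x : ℂ) * (G.m x : ℂ) = 1 := by
    exact_mod_cast sum_leftVec_mul_mass (hG.restrict F) R
  simp only [Jdown_apply, leftVec_mul_congr (hG.restrict F) (g := fun _ => z) hf]
  calc ∑ x, ((G.restrict F).leftVec R x : ℂ) * z * (G.m x : ℂ)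
      = z * ∑ x, ((G.restrict F).leftVec R x : ℂ) * (G.m x : ℂ) := by
        rw [Finset.mul_sum]
        exact Finset.sum_congr rfl fun x _ => by ring
    _ = z := by rw [hmass, mul_one]

lemma Jdown_Jup (hG : G.IsGraph) (g : (G.restrict F).Reach → ℂ) : G.Jdown F (G.Jup F g) = g :=
  funext fun _ => Jdown_eq_of_forall_isRoot hG fun _ hr => Jup_apply_of_isRoot hr g

lemma Jdown_inLap_apply (hG : G.IsGraph) {H : WeightedDigraph V} (hm : H.m = G.m) (f : V → ℂ)
    (R : (G.restrict F).Reach) : G.Jdown F (H.inLap f) R =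
      ∑ x, ((G.restrict F).leftVec R x : ℂ) * ∑ y, (H.a x y : ℂ) * (f x - f y) := by
  rw [Jdown_apply]
  refine Finset.sum_congr rfl fun x _ => ?_
  have hmx : (G.m x : ℂ) ≠ 0 := Complex.ofReal_ne_zero.2 (hG.m_pos x).ne'
  rw [show H.inLap f x = _ from inLapLin_apply f x, hm, RCLike.ofReal_eq_complex_ofReal]
  field_simp

lemma Jdown_inLap (hG : G.IsGraph) (f : V → ℂ) : G.Jdown F ((G.restrict F).inLap f) = 0 := by
  funext R
  have hbalance (x : V) : ∑ y, ((G.restrict F).leftVec R x : ℂ) * ((G.restrict F).a x y : ℂ) =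
      ∑ z, ((G.restrict F).leftVec R z : ℂ) * ((G.restrict F).a z x : ℂ) := by
    rw [← Finset.mul_sum]
    exact_mod_cast leftVec_mul_inDegree (hG.restrict F) R x
  rw [Jdown_inLap_apply hG (H := G.restrict F) rfl, Pi.zero_apply]
  simp only [mul_sub, Finset.sum_sub_distrib, Finset.mul_sum, ← mul_assoc]
  rw [sub_eq_zero, Finset.sum_comm (f := fun x y =>
    ((G.restrict F).leftVec R x : ℂ) * ((G.restrict F).a x y : ℂ) * f y)]
  exact Finset.sum_congr rfl fun x _ => by rw [← Finset.sum_mul, ← Finset.sum_mul, hbalance]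

lemma inLap_Jup (hG : G.IsGraph) (g : (G.restrict F).Reach → ℂ) :
    (G.restrict F).inLap (G.Jup F g) = 0 :=
  inLapLin_sum_mul_rightVec (hG.restrict F) g

/-- The composition `J↑ J↓`, which turns out to be the projection onto the kernel of the in-degree
Laplacian of `F`. -/
noncomputable def kerProj (G : WeightedDigraph V) (F : Set (V × V)) : (V → ℂ) →L[ℂ] (V → ℂ) :=
  G.Jup F ∘L G.Jdown F

lemma kerProj_eq_self_of_inLap_eq_zero (hG : G.IsGraph) {f : V → ℂ}
    (hf : (G.restrict F).inLap f = 0) : G.kerProj F f = f := by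
  choose ρ hρ using exists_isRoot (G := G.restrict F)
  have hJup : f = G.Jup F (fun R => f (ρ R)) :=
    funext (eq_sum_rightVec_of_inLapLin_eq_zero (hG.restrict F) hρ hf)
  rw [hJup]
  exact congrArg (G.Jup F) (Jdown_Jup hG _)

theorem isKernelProjection_kerProj (hG : G.IsGraph) (F : Set (V × V)) :
    IsKernelProjection (G.restrict F).inLap (G.kerProj F) where
  mul_proj := ContinuousLinearMap.ext fun f => inLap_Jup hG (G.Jdown F f)
  proj_mul := ContinuousLinearMap.ext fun f =>
    (congrArg (G.Jup F) (Jdown_inLap hG f)).trans (map_zero (G.Jup F))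
  isIdempotentElem := ContinuousLinearMap.ext fun f =>
    congrArg (G.Jup F) (Jdown_Jup hG (G.Jdown F f))
  isUnit_add := by
    rw [ContinuousLinearMap.isUnit_iff_bijective]
    have hinj : Function.Injective ((G.restrict F).inLap + G.kerProj F) := by
      refine (injective_iff_map_eq_zero _).2 fun f hf => ?_
      have hJdown : G.Jdown F f = 0 := by
        calc G.Jdown F f
            = G.Jdown F ((G.restrict F).inLap f + G.Jup F (G.Jdown F f)) := by
              rw [map_add, Jdown_inLap hG, Jdown_Jup hG, zero_add]
          _ = G.Jdown F 0 := congrArg _ hf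
          _ = 0 := map_zero _
      have hker : G.kerProj F f = 0 := (congrArg (G.Jup F) hJdown).trans (map_zero _)
      have hLap : (G.restrict F).inLap f = 0 := by
        rwa [_root_.add_apply, hker, add_zero] at hf
      rw [← kerProj_eq_self_of_inLap_eq_zero hG hLap, hker]
    exact ⟨hinj, ((G.restrict F).inLap + G.kerProj F).toLinearMap.surjective_of_injective hinj⟩

/-! ### The reduced graph -/

open Classical in
lemma Jdown_indicator (hG : G.IsGraph) (R : (G.restrict F).Reach) :
    G.Jdown F (Set.indicator R.1 1) = Pi.single R 1 := by
  funext S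
  refine Jdown_eq_of_forall_isRoot hG fun r hr => ?_
  obtain rfl | hSR := eq_or_ne S R
  · rw [Set.indicator_of_mem hr.mem, Pi.one_apply, Pi.single_eq_same]
  · rw [Pi.single_eq_of_ne hSR,
      Set.indicator_of_notMem fun hrR => hSR (hr.eq_of_mem hrR).symm]

lemma kerProj_indicator (hG : G.IsGraph) (R : (G.restrict F).Reach) (v : V) :
    G.kerProj F (Set.indicator R.1 1) v = ((G.restrict F).rightVec R v : ℂ) := by
  classical
  rw [kerProj, ContinuousLinearMap.comp_apply, Jdown_indicator hG, Jup_apply]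
  simp [Pi.single_apply]

lemma reduced_m (hG : G.IsGraph) (R : (G.restrict F).Reach) :
    (G.reduced F).m R = ∑ v, (G.restrict F).rightVec R v * G.m v := by
  change (G.ellInner _ _).re = _
  rw [(isKernelProjection_kerProj hG F).rieszProj_eq, ellInner, Complex.re_sum]
  refine Finset.sum_congr rfl fun v _ => ?_
  rw [kerProj_indicator hG]
  by_cases hv : v ∈ R.1
  · simp [hv]
  · simp [hv, rightVec_of_notMem hv]

lemma reduced_m_pos (hG : G.IsGraph) (R : (G.restrict F).Reach) : 0 < (G.reduced F).m R := by
  obtain ⟨r, hr⟩ := exists_isRoot R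
  rw [reduced_m hG]
  refine Finset.sum_pos' (fun v _ => mul_nonneg (rightVec_nonneg (hG.restrict F) R v)
    (hG.m_pos v).le) ⟨r, Finset.mem_univ r, ?_⟩
  rw [rightVec_of_mem_exclusivePart hr.mem_exclusivePart, one_mul]
  exact hG.m_pos r

lemma reduced_a (hG : G.IsGraph) (R S : (G.restrict F).Reach) :
    (G.reduced F).a R S = (G.reduced F).m R * ∑ r, ∑ s,
      (G.restrict F).leftVec R r * G.a r s * (G.restrict F).rightVec S s := by
  refine congrArg ((G.reduced F).m R * ·)
    (Finset.sum_congr rfl fun r _ => Finset.sum_congr rfl fun s _ => ?_)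
  by_cases hr : r ∈ R.1
  · by_cases hs : s ∈ S.1
    · simp [hr, hs]
    · simp [hs, rightVec_of_notMem hs]
  · simp [hr, leftVec_eq_zero (hG.restrict F) fun h : IsRoot R r => hr h.mem]

theorem reduced_isGraph (hG : G.IsGraph) (F : Set (V × V)) : (G.reduced F).IsGraph where
  m_pos := reduced_m_pos hG
  a_nonneg R S := by
    rw [reduced_a hG]
    exact mul_nonneg (reduced_m_pos hG R).le <| Finset.sum_nonneg fun r _ =>
      Finset.sum_nonneg fun s _ => mul_nonneg (mul_nonneg (leftVec_nonneg (hG.restrict F) R r)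
        (hG.a_nonneg r s)) (rightVec_nonneg (hG.restrict F) S s)
  mem_E _ _ := Iff.rfl

lemma inLap_restrict_diff_add (hG : G.IsGraph) (F : Set (V × V)) :
    (G.restrict (G.E \ F)).inLap + (G.restrict F).inLap = G.inLap := by
  ext f x
  have ha (y : V) : ((G.restrict (G.E \ F)).a x y : ℂ) + ((G.restrict F).a x y : ℂ) = G.a x y := by
    by_cases hE : (x, y) ∈ G.E
    · by_cases hF : (x, y) ∈ F <;> simp [restrict, hE, hF]
    · simp [restrict, hE, hG.a_eq_zero hE]
  rw [_root_.add_apply, Pi.add_apply]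
  refine (congrArg₂ (· + ·) (inLapLin_apply f x) (inLapLin_apply f x)).trans
    (Eq.trans ?_ (inLapLin_apply f x).symm)
  rw [show (G.restrict (G.E \ F)).m = G.m from rfl, show (G.restrict F).m = G.m from rfl,
    ← mul_add, ← Finset.sum_add_distrib]
  simp only [← add_mul, RCLike.ofReal_eq_complex_ofReal, ha]

lemma sum_rightVec_mul_sub (hG : G.IsGraph) (g : (G.restrict F).Reach → ℂ) (z : ℂ) (v : V) :
    ∑ S, ((G.restrict F).rightVec S v : ℂ) * (z - g S) = z - G.Jup F g v := by
  have hone : ∑ S, ((G.restrict F).rightVec S v : ℂ) = 1 := by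
    exact_mod_cast sum_rightVec (hG.restrict F) v
  simp only [mul_sub, Finset.sum_sub_distrib, ← Finset.sum_mul, hone, one_mul, Jup_apply,
    mul_comm (g _)]

theorem reduced_inLap (hG : G.IsGraph) (F : Set (V × V)) :
    (G.reduced F).inLap = G.Jdown F ∘L (G.restrict (G.E \ F)).inLap ∘L G.Jup F := by
  ext g R
  have hm : ((G.reduced F).m R : ℂ) ≠ 0 := Complex.ofReal_ne_zero.2 (reduced_m_pos hG R).ne'
  calc (G.reduced F).inLap g R
      = 1 / ((G.reduced F).m R : ℂ) * ∑ S, ((G.reduced F).a R S : ℂ) * (g R - g S) :=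
        inLapLin_apply g R
    _ = ∑ S, ∑ r, ∑ s, ((G.restrict F).leftVec R r : ℂ) * ((G.a r s : ℂ) *
          (((G.restrict F).rightVec S s : ℂ) * (g R - g S))) := by
        simp only [reduced_a hG, Complex.ofReal_mul, Complex.ofReal_sum, mul_assoc, Finset.sum_mul]
        rw [← Finset.mul_sum, ← mul_assoc, one_div_mul_cancel hm, one_mul]
    _ = ∑ r, ((G.restrict F).leftVec R r : ℂ) *
          ∑ s, (G.a r s : ℂ) * ∑ S, ((G.restrict F).rightVec S s : ℂ) * (g R - g S) := by
        simp only [Finset.mul_sum]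
        rw [Finset.sum_comm]
        exact Finset.sum_congr rfl fun r _ => Finset.sum_comm
    _ = ∑ r, ((G.restrict F).leftVec R r : ℂ) *
          ∑ s, (G.a r s : ℂ) * (G.Jup F g r - G.Jup F g s) := by
        simp only [sum_rightVec_mul_sub hG]
        refine Finset.sum_congr rfl fun r _ => leftVec_mul_congr (hG.restrict F)
          (f := fun r => ∑ s, (G.a r s : ℂ) * (g R - G.Jup F g s))
          (g := fun r => ∑ s, (G.a r s : ℂ) * (G.Jup F g r - G.Jup F g s)) (fun r hr => ?_) r
        rw [Jup_apply_of_isRoot hr]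
    _ = G.Jdown F (G.inLap (G.Jup F g)) R := (Jdown_inLap_apply hG rfl _ R).symm
    _ = G.Jdown F ((G.restrict (G.E \ F)).inLap (G.Jup F g)) R := by
        rw [← inLap_restrict_diff_add hG F, _root_.add_apply, inLap_Jup hG, add_zero]

/-! ### Convergence in the operator norm of `ℓ²(G)` -/

lemma ellNorm_le (hG : G.IsGraph) (f : V → ℂ) : G.ellNorm f ≤ √(∑ x, G.m x) * ‖f‖ := by
  rw [← Real.sqrt_sq (norm_nonneg f), ← Real.sqrt_mul (Finset.sum_nonneg fun x _ =>
    (hG.m_pos x).le), Finset.sum_mul]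
  refine Real.sqrt_le_sqrt (Finset.sum_le_sum fun x _ => ?_)
  rw [mul_comm]
  have := hG.m_pos x
  gcongr
  exact norm_le_pi_norm f x

lemma norm_le_ellNorm (hG : G.IsGraph) (f : V → ℂ) :
    ‖f‖ ≤ (∑ x, (√(G.m x))⁻¹) * G.ellNorm f := by
  have hnonneg : 0 ≤ G.ellNorm f := Real.sqrt_nonneg _
  refine (pi_norm_le_iff_of_nonneg (by positivity)).2 fun x => ?_
  have hterm : √(G.m x) * ‖f x‖ ≤ G.ellNorm f := by
    rw [mul_comm, ← Real.sqrt_sq (norm_nonneg (f x)), ← Real.sqrt_mul (sq_nonneg _)]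
    exact Real.sqrt_le_sqrt (Finset.single_le_sum (f := fun x => ‖f x‖ ^ 2 * G.m x)
      (fun y _ => mul_nonneg (sq_nonneg _) (hG.m_pos y).le) (Finset.mem_univ x))
  calc ‖f x‖ ≤ (√(G.m x))⁻¹ * G.ellNorm f :=
        (le_inv_mul_iff₀ (Real.sqrt_pos.2 (hG.m_pos x))).2 hterm
    _ ≤ (∑ x, (√(G.m x))⁻¹) * G.ellNorm f := by
        gcongr
        exact Finset.single_le_sum (f := fun x => (√(G.m x))⁻¹) (fun y _ => by positivity)
          (Finset.mem_univ x)

lemma ellOpNorm_le (hG : G.IsGraph) (T : (V → ℂ) →L[ℂ] (V → ℂ)) :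
    G.ellOpNorm T ≤ √(∑ x, G.m x) * ‖T‖ * ∑ x, (√(G.m x))⁻¹ := by
  refine csInf_le ⟨0, fun _ hC => hC.1⟩ ⟨by positivity, fun f => ?_⟩
  calc G.ellNorm (T f) ≤ √(∑ x, G.m x) * ‖T f‖ := ellNorm_le hG _
    _ ≤ √(∑ x, G.m x) * (‖T‖ * ‖f‖) := by gcongr; exact T.le_opNorm f
    _ ≤ √(∑ x, G.m x) * (‖T‖ * ((∑ x, (√(G.m x))⁻¹) * G.ellNorm f)) := by
        gcongr
        exact norm_le_ellNorm hG f
    _ = √(∑ x, G.m x) * ‖T‖ * (∑ x, (√(G.m x))⁻¹) * G.ellNorm f := by ring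

lemma tendsto_ellOpNorm_sub_zero (hG : G.IsGraph) {ι : Type*} {l : Filter ι}
    {T : ι → (V → ℂ) →L[ℂ] (V → ℂ)} {T₀ : (V → ℂ) →L[ℂ] (V → ℂ)}
    (hT : Filter.Tendsto T l (nhds T₀)) :
    Filter.Tendsto (fun i => G.ellOpNorm (T i - T₀)) l (nhds 0) := by
  refine squeeze_zero (fun _ => Real.sInf_nonneg fun _ hC => hC.1) (fun _ => ellOpNorm_le hG _) ?_
  simpa using ((tendsto_iff_norm_sub_tendsto_zero.1 hT).const_mul
    (√(∑ x, G.m x))).mul_const (∑ x, (√(G.m x))⁻¹)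

lemma norm_smul_one_sub_inLap_le (hG : G.IsGraph) {c : ℝ} (hc : 0 ≤ c)
    (hd : ∀ x, G.inDegree x / G.m x ≤ c) : ‖c • 1 - G.inLap‖ ≤ c := by
  refine ContinuousLinearMap.opNorm_le_bound _ hc fun f => ?_
  refine (pi_norm_le_iff_of_nonneg (by positivity)).2 fun x => ?_
  have hm := hG.m_pos x
  have hvalue : (c • 1 - G.inLap) f x =
      ((c - G.inDegree x / G.m x : ℝ) : ℂ) * f x +
        ((1 / G.m x : ℝ) : ℂ) * ∑ y, (G.a x y : ℂ) * f y := by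
    change c • f x - (1 / (G.m x : ℂ)) * ((G.inDegree x : ℂ) * f x - ∑ y, (G.a x y : ℂ) * f y) = _
    rw [Complex.real_smul]
    push_cast
    ring
  have hsum : ‖∑ y, (G.a x y : ℂ) * f y‖ ≤ G.inDegree x * ‖f‖ := by
    rw [inDegree, Finset.sum_mul]
    refine norm_sum_le_of_le _ fun y _ => ?_
    rw [norm_mul, Complex.norm_of_nonneg (hG.a_nonneg x y)]
    exact mul_le_mul_of_nonneg_left (norm_le_pi_norm f y) (hG.a_nonneg x y)
  calc ‖(c • 1 - G.inLap) f x‖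
      ≤ (c - G.inDegree x / G.m x) * ‖f‖ + 1 / G.m x * (G.inDegree x * ‖f‖) := by
        rw [hvalue]
        refine norm_add_le_of_le ?_ ?_ <;> rw [norm_mul, Complex.norm_of_nonneg]
        · exact mul_le_mul_of_nonneg_left (norm_le_pi_norm f x) (sub_nonneg.2 (hd x))
        · exact sub_nonneg.2 (hd x)
        · gcongr
        · positivity
    _ = c * ‖f‖ := by ring

lemma exists_norm_smul_one_sub_inLap_le (hG : G.IsGraph) : ∃ c : ℝ, ‖c • 1 - G.inLap‖ ≤ c := by
  have hnonneg (x : V) : 0 ≤ G.inDegree x / G.m x :=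
    div_nonneg (Finset.sum_nonneg fun y _ => hG.a_nonneg x y) (hG.m_pos x).le
  exact ⟨∑ x, G.inDegree x / G.m x, norm_smul_one_sub_inLap_le hG
    (Finset.sum_nonneg fun x _ => hnonneg x)
    fun x => Finset.single_le_sum (fun y _ => hnonneg y) (Finset.mem_univ x)⟩

lemma Jup_comp_exp_comp_Jdown (hG : G.IsGraph) (F : Set (V × V)) (t : ℝ) :
    G.Jup F ∘L NormedSpace.exp (-(t : ℂ) • (G.reduced F).inLap) ∘L G.Jdown F =
      G.kerProj F * NormedSpace.exp (-t • ((G.restrict (G.E \ F)).inLap * G.kerProj F)) := by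
  have hintertwine : G.Jdown F ∘L (-t • ((G.restrict (G.E \ F)).inLap * G.kerProj F)) =
      (-(t : ℂ) • (G.reduced F).inLap) ∘L G.Jdown F := by
    rw [reduced_inLap hG, ContinuousLinearMap.smul_comp, ← Complex.ofReal_neg]
    exact ContinuousLinearMap.comp_smul (G.Jdown F) ((-t : ℝ) : ℂ)
      ((G.restrict (G.E \ F)).inLap * G.kerProj F)
  rw [← comp_exp_eq_exp_comp hintertwine]
  rfl

theorem tendsto_exp_neg_smul_inLapBeta (hG : G.IsGraph) (F : Set (V × V)) {t : ℝ} (ht : 0 < t) :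
    Filter.Tendsto (fun β : ℝ => NormedSpace.exp (-(t : ℂ) • G.inLapBeta F β)) Filter.atTop
      (nhds (G.Jup F ∘L NormedSpace.exp (-(t : ℂ) • (G.reduced F).inLap) ∘L G.Jdown F)) := by
  obtain hV | hV := isEmpty_or_nonempty V
  · exact tendsto_nhds_of_eventually_eq (.of_forall fun _ => Subsingleton.elim _ _)
  obtain ⟨a, hA⟩ := exists_norm_smul_one_sub_inLap_le (hG.restrict (G.E \ F))
  obtain ⟨b, hB⟩ := exists_norm_smul_one_sub_inLap_le (hG.restrict F)
  have hP := isKernelProjection_kerProj hG F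
  obtain ⟨S, hS⟩ := hP.exists_mul_eq_one_sub
  rw [Jup_comp_exp_comp_Jdown hG]
  simp only [inLapBeta, ← Complex.ofReal_neg]
  exact tendsto_exp_neg_smul_add_smul hA hB ht hP.mul_proj hS

end WeightedDigraph

theorem mainTheorem6 {V : Type*} [Fintype V] (G : WeightedDigraph V) (hG : G.IsGraph)
    (F : Set (V × V)) (hF : F ⊆ G.E) :
    (G.reduced F).IsGraph ∧
      ∀ t : ℝ, 0 < t →
        Filter.Tendsto
          (fun β : ℝ => G.ellOpNorm
            (NormedSpace.exp (-(t : ℂ) • G.inLapBeta F β) -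
              (G.Jup F) ∘L (NormedSpace.exp (-(t : ℂ) • (G.reduced F).inLap)) ∘L (G.Jdown F)))
          Filter.atTop (nhds 0) :=
  ⟨WeightedDigraph.reduced_isGraph hG F, fun _ ht =>
    WeightedDigraph.tendsto_ellOpNorm_sub_zero hG
      (WeightedDigraph.tendsto_exp_neg_smul_inLapBeta hG F ht)⟩
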